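/- Let $X$ be a smooth, projective, geometrically connected curve over the finite field $\mathbb{F}_q$ with function field $F$, and let $k$ be an algebraic closure of $\mathbb{F}_q$, with $\mathrm{Fr}_q(a)=a^q$. For a closed point $x$ of $X$ let $\mathcal{O}_x$ be the completed local ring, $F_x$ its fraction field, $\mathbb{F}_x$ its residue field, and $\deg(x)=[\mathbb{F}_x:\mathbb{F}_q]$. Fix closed points $\infty\neq o$ of $X$ and an $\mathbb{F}_q$-embedding $\mathbb{F}_o\hookrightarrow k$, and let $z:\mathrm{Spec}(k)\to X\otimes_{\mathbb{F}_q}k$ be the resulting $k$-point. Let $D$ be a central division algebra over $F$ of dimension $d^2$ such that $D\otimes_F F_\infty\cong \mathbb{M}_d(F_\infty)$ and such that $D_o=D\otimes_F F_o$ is the central division algebra over $F_o$ with invariant $1/d$, i.e. it is generated by the unramified extension of $F_o$ of degree $d$ and an element $\Pi_o$ such that $\Pi_o a\Pi_o^{-1}=\mathrm{Frob}(a)$ for $a$ in this extension ($\mathrm{Frob}$ being its Frobenius over $F_o$) and $\Pi_o^d$ is a uniformizer of $F_o$. Fix a maximal $\mathcal{O}_X$-order $\mathcal{D}$ in $D$.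 A $\mathcal{D}$-elliptic sheaf of characteristic $o$ over $k$ is a sequence $\mathbb{E}=(\mathcal{E}_i,j_i,t_i)_{i\in\mathbb{Z}}$, where $\mathcal{E}_i$ is a locally free $\mathcal{O}_{X\otimes_{\mathbb{F}_q} k}$-module of rank $d^2$ with a right action of $\mathcal{D}$ extending the $\mathcal{O}_X$-action, and $j_i:\mathcal{E}_i\hookrightarrow\mathcal{E}_{i+1}$ and $t_i:{}^\tau\mathcal{E}_i:=(\mathrm{Id}_X\otimes\mathrm{Fr}_q)^*\mathcal{E}_i\hookrightarrow\mathcal{E}_{i+1}$ are injective $\mathcal{D}$-linear homomorphisms such that for all $i$: (1) $j_{i}\circ t_{i-1}=t_{i}\circ{}^\tau j_{i-1}$; (2) $\mathcal{E}_{i+d\deg(\infty)}=\mathcal{E}_i\otimes_{\mathcal{O}_X}\mathcal{O}_X(\infty)$, the composite of the $j$'s from $\mathcal{E}_i$ to $\mathcal{E}_{i+d\deg(\infty)}$ being induced by $\mathcal{O}_X\hookrightarrow\mathcal{O}_X(\infty)$; (3) $\dim_k H^0(X\otimes k,\mathrm{coker}\, j_i)=d$; (4) $\mathcal{E}_i/t_{i-1}({}^\tau\mathcal{E}_{i-1})\cong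 z_*\mathcal{H}_i$ with $\mathcal{H}_i$ a $k$-vector space of dimension $d$. Let $N$ be the generic fibre of $\mathcal{E}_0$, let $\varphi:N\to N$ be the $F\otimes\mathrm{Fr}_q$-linear bijection induced by $j_0^{-1}\circ t_0$, let $M_o=H^0(\mathrm{Spec}(\mathcal{O}_o\widehat{\otimes}_{\mathbb{F}_q}k),\mathcal{E}_0)$, and let $\varphi_o$ be the map induced by $\varphi$ on $F_o\otimes_{\mathcal{O}_o}M_o$. One calls $\mathbb{E}$ exceptional if $\varphi_o^{\deg(o)}(M_o)=M_o\Pi_o$. Let $\mathbb{E}$ be an exceptional $\mathcal{D}$-elliptic sheaf of characteristic $o$ over $k$, and let $\mathcal{A}$ be the sheaf on $X$ of endomorphisms of $\mathbb{E}$: for non-empty open $U\subseteq X$, $\Gamma(U,\mathcal{A})$ is the ring of families $(\psi_i)_{i\in\mathbb{Z}}$ of $\mathcal{D}$-linear endomorphisms $\psi_i$ of $\mathcal{E}_i|_{U\otimes k}$ that commute with all $j_i$ and $t_i$. Put $\mathrm{Aut}(\mathbb{E})=\Gamma(X,\mathcal{A}^\times)=\Gamma(X,\mathcal{A})^\times$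 and $\Lambda=\Gamma(X-\infty,\mathcal{A})$. Then the restriction map $\mathrm{Aut}(\mathbb{E})\to\Lambda^\times$ is an isomorphism of groups, and there is an $s$ dividing $d$ such that $\Lambda^\times\cong\mathbb{F}_{q^s}^\times$. -/

import Mathlib

open scoped TensorProduct

noncomputable section

namespace DElliptic

/-- `F` is the function field of a smooth, projective, geometrically connected curve `X` over the
finite (hence perfect) field `𝔽`: a finitely generated field extension of transcendence degree one
in which `𝔽` is algebraically closed. The curve `X` is recovered from `F`: its closed points are
the places of `F`. -/
structure IsCurveFunctionField (𝔽 F : Type*) [Field 𝔽] [Field F] [Algebra 𝔽 F] : Prop where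
  essFiniteType : Algebra.EssFiniteType 𝔽 F
  trdeg_eq_one : Algebra.trdeg 𝔽 F = 1
  algebraicClosure_eq_bot : algebraicClosure 𝔽 F = ⊥

/-- A place of `F / 𝔽`, i.e. a closed point `x` of the curve `X`, given by its local ring
`𝒪_{X,x} ⊂ F`. -/
structure Place (𝔽 F : Type*) [Field 𝔽] [Field F] [Algebra 𝔽 F] where
  ring : ValuationSubring F
  algebraMap_mem : ∀ a : 𝔽, algebraMap 𝔽 F a ∈ ring
  ne_top : ring ≠ ⊤

section Places

variable {𝔽 F : Type*} [Field 𝔽] [Field F] [Algebra 𝔽 F]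

instance Place.algebraRing (x : Place 𝔽 F) : Algebra 𝔽 x.ring :=
  ((algebraMap 𝔽 F).codRestrict x.ring.toSubring x.algebraMap_mem).toAlgebra

instance Place.isScalarTowerRing (x : Place 𝔽 F) : IsScalarTower 𝔽 x.ring F :=
  IsScalarTower.of_algebraMap_eq fun _ => rfl

/-- The residue field `𝔽_x`. -/
abbrev Place.Residue (x : Place 𝔽 F) : Type _ := IsLocalRing.ResidueField x.ring

/-- The degree `[𝔽_x : 𝔽]`. -/
def Place.deg (x : Place 𝔽 F) : ℕ := Module.finrank 𝔽 x.Residue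

/-- The completion `F_x` of `F` at `x`. -/
abbrev Place.Completion (x : Place 𝔽 F) : Type _ := x.ring.valuation.Completion

instance Place.algebraCompletion (x : Place 𝔽 F) : Algebra F x.Completion :=
  ((algebraMap (WithVal x.ring.valuation) x.Completion).comp
    (WithVal.equiv x.ring.valuation).symm.toRingHom).toAlgebra

/-- The subring `𝒪_{X,x} ⊗ k` of `F ⊗ k`. -/
def Place.baseChange (k : Type*) [Field k] [Algebra 𝔽 k] (x : Place 𝔽 F) :
    Subalgebra 𝔽 (F ⊗[𝔽] k) :=
  (Algebra.TensorProduct.map (IsScalarTower.toAlgHom 𝔽 x.ring F) (AlgHom.id 𝔽 k)).range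

/-- The stalk at `x` of the sheaf `𝒪_X(p)`: the functions whose product with every element of
`𝒪_{X,x}` (with every element of the maximal ideal, if `x = p`) is regular at `x`. -/
def Place.divisorStalk (p x : Place 𝔽 F) : Set F :=
  {g | ∀ f : x.ring, (x = p → f ∈ IsLocalRing.maximalIdeal x.ring) → (f : F) * g ∈ x.ring}

variable (D : Type*) [Ring D] [Algebra F D]

/-- The completed algebra `D_x = D ⊗_F F_x`. -/
abbrev Place.LocalAlgebra (x : Place 𝔽 F) : Type _ := x.Completion ⊗[F] D

/-- `D` (of dimension `d²`) is split at `x`. -/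
def Place.IsSplit (x : Place 𝔽 F) (d : ℕ) : Prop :=
  Nonempty (x.LocalAlgebra D ≃ₐ[x.Completion] Matrix (Fin d) (Fin d) x.Completion)

/-- `D_x` (of dimension `d²`) is the division algebra with invariant `1/d` over `F_x`. It is
generated over `F_x` by the unramified extension of degree `d`, that is `F_x(ζ)` with `ζ` a root
of unity of order `q_x ^ d - 1`, and by an element `Π` which acts on this extension by conjugation
as the Frobenius over `F_x` and whose `d`-th power is a uniformizer of `F_x`. -/
def Place.HasInvariantOneDiv (x : Place 𝔽 F) (d : ℕ) : Prop :=
  (∀ a : x.LocalAlgebra D, a ≠ 0 → IsUnit a) ∧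
  ∃ (π : x.ring) (ζ P : x.LocalAlgebra D),
    IsLocalRing.maximalIdeal x.ring = Ideal.span {π} ∧
    orderOf ζ = Nat.card x.Residue ^ d - 1 ∧
    P * ζ = ζ ^ Nat.card x.Residue * P ∧
    P ^ d = algebraMap F (x.LocalAlgebra D) (π : F)

end Places

/-- An `𝒪_X`-order in `D`: a locally free sheaf of `𝒪_X`-algebras with generic fibre `D`, given by
its stalks `𝒟_x ⊂ D`. The sections over an open `U` are the intersection of the `𝒟_x`, `x ∈ U`. The
non-empty open subsets of `X` are the sets of places with finite complement (together with the
generic point). -/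
structure OrderSheaf (𝔽 F D : Type*) [Field 𝔽] [Field F] [Algebra 𝔽 F] [Ring D] [Algebra F D] where
  stalk : Place 𝔽 F → Subring D
  algebraMap_mem : ∀ (x : Place 𝔽 F) (f : F), f ∈ x.ring → algebraMap F D f ∈ stalk x
  locallyFree : ∀ x : Place 𝔽 F,
    ∃ (b : Module.Basis (Fin (Module.finrank F D)) F D) (U : Set (Place 𝔽 F)),
      x ∈ U ∧ Uᶜ.Finite ∧ ∀ y ∈ U, ∀ a : D, a ∈ stalk y ↔ ∀ m, b.repr a m ∈ y.ring

/-- `S` is an `𝒪_{X,x}`-order in `D`: a subring that is a full `𝒪_{X,x}`-lattice. -/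
def IsOrderAt {𝔽 F D : Type*} [Field 𝔽] [Field F] [Algebra 𝔽 F] [Ring D] [Algebra F D]
    (x : Place 𝔽 F) (S : Subring D) : Prop :=
  (∃ M : Submodule x.ring D, M.FG ∧ (M : Set D) = S) ∧ Submodule.span F (S : Set D) = ⊤

/-- The order is maximal (at every place). -/
def OrderSheaf.IsMaximal {𝔽 F D : Type*} [Field 𝔽] [Field F] [Algebra 𝔽 F] [Ring D] [Algebra F D]
    (𝒟 : OrderSheaf 𝔽 F D) : Prop :=
  ∀ (x : Place 𝔽 F) (S : Subring D), IsOrderAt x S → 𝒟.stalk x ≤ S → S = 𝒟.stalk x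

section Sheaves

universe v

variable {𝔽 F D : Type*} [Field 𝔽] [Field F] [Algebra 𝔽 F] [Ring D] [Algebra F D]

attribute [local instance] TensorProduct.Algebra.module

/-- A locally free sheaf `ℰ` of rank `n` on `X ⊗ k` with a right action of `𝒟` extending the
action of `𝒪_X`. It is given by its generic fibre `V`, a vector space over `F ⊗ k` with a right
action of `D`, and, for every closed point `x` of `X`, by its stalk along `x`, an
`𝒪_{X,x} ⊗ k`-submodule of `V`: the sections over `U ⊗ k`, `U ⊂ X` open, are the elements of `V`
that lie in the stalk at every `x ∈ U`. -/
structure Bundle (𝒟 : OrderSheaf 𝔽 F D) (k : Type*) [Field k] [Algebra 𝔽 k] (n : ℕ) where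
  V : Type v
  [addCommGroup : AddCommGroup V]
  [moduleBase : Module 𝔽 V]
  [moduleF : Module F V]
  [moduleK : Module k V]
  [moduleD : Module Dᵐᵒᵖ V]
  [towerF : IsScalarTower 𝔽 F V]
  [towerK : IsScalarTower 𝔽 k V]
  [towerD : IsScalarTower F Dᵐᵒᵖ V]
  [commF : SMulCommClass F k V]
  [commD : SMulCommClass k Dᵐᵒᵖ V]
  stalk : Place 𝔽 F → Submodule k V
  smul_mem : ∀ (x : Place 𝔽 F) (a : D) (w : V),
    a ∈ 𝒟.stalk x → w ∈ stalk x → MulOpposite.op a • w ∈ stalk x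
  locallyFree : ∀ x : Place 𝔽 F,
    ∃ (b : Module.Basis (Fin n) (F ⊗[𝔽] k) V) (U : Set (Place 𝔽 F)),
      x ∈ U ∧ Uᶜ.Finite ∧ ∀ y ∈ U, ∀ w : V, w ∈ stalk y ↔ ∀ m, b.repr w m ∈ y.baseChange k

attribute [instance] Bundle.addCommGroup Bundle.moduleBase Bundle.moduleF Bundle.moduleK
  Bundle.moduleD Bundle.towerF Bundle.towerK Bundle.towerD Bundle.commF Bundle.commD

variable {𝒟 : OrderSheaf 𝔽 F D} {k : Type*} [Field k] [Algebra 𝔽 k] {n : ℕ}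

/-- The stalk at `x` of `ℰ ⊗ 𝒪_X(p)`, inside the generic fibre of `ℰ`. -/
def Bundle.twistStalk (ℰ : Bundle.{v} 𝒟 k n) (p x : Place 𝔽 F) : Submodule k ℰ.V :=
  Submodule.span k {u | ∃ g ∈ p.divisorStalk x, ∃ w ∈ ℰ.stalk x, u = g • w}

/-- For a sequence of maps `j_i : ℰ_i → ℰ_{i+1}`, the composite map `ℰ_i → ℰ_{i+m}`. -/
def iterMap (ℰ : ℤ → Bundle.{v} 𝒟 k n) (j : ∀ i, (ℰ i).V →ₗ[k] (ℰ (i + 1)).V) (i : ℤ) :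
    (m : ℕ) → (ℰ i).V →ₗ[k] (ℰ (i + m)).V
  | 0 => (LinearEquiv.cast (R := k) (M := fun i => (ℰ i).V) (by simp)).toLinearMap
  | m + 1 => (LinearEquiv.cast (R := k) (M := fun i => (ℰ i).V)
      (by push_cast; ring : i + (m : ℤ) + 1 = i + ((m + 1 : ℕ) : ℤ))).toLinearMap ∘ₗ
        j (i + m) ∘ₗ iterMap ℰ j i m

variable [Fintype 𝔽] [IsAlgClosure 𝔽 k]

variable (𝔽 k) in
/-- The automorphism `a ↦ a ^ q` of `k`. -/
def frob : k →+* k :=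
  haveI : Algebra.IsAlgebraic 𝔽 k := IsAlgClosure.isAlgebraic
  (FiniteField.frobeniusAlgEquivOfAlgebraic 𝔽 k : k ≃+* k)

instance frobSurjective : RingHomSurjective (frob 𝔽 k) :=
  ⟨by
    have : Algebra.IsAlgebraic 𝔽 k := IsAlgClosure.isAlgebraic
    exact (FiniteField.frobeniusAlgEquivOfAlgebraic 𝔽 k).surjective⟩

/-- A `𝒟`-elliptic sheaf `(ℰ_i, j_i, t_i)` of characteristic `o` over `k`, with pole `p` (the
point `∞`). The homomorphism `t_i` from the Frobenius pull-back of `ℰ_i` to `ℰ_{i+1}` is given as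
an `F ⊗ Fr_q`-semilinear map on the generic fibres that maps stalks to stalks; as `Id ⊗ Fr_q` is an
automorphism of `X ⊗ k` over `X`, the image of the stalk of the pull-back is the image of the
stalk of `ℰ_i`. -/
structure EllipticSheaf (𝒟 : OrderSheaf 𝔽 F D) (d : ℕ) (p o : Place 𝔽 F)
    (z : o.Residue →ₐ[𝔽] k) where
  ℰ : ℤ → Bundle.{v} 𝒟 k (d ^ 2)
  j : ∀ i, (ℰ i).V →ₗ[k] (ℰ (i + 1)).V
  t : ∀ i, (ℰ i).V →ₛₗ[frob 𝔽 k] (ℰ (i + 1)).V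
  j_smul : ∀ i (a : D) w, j i (MulOpposite.op a • w) = MulOpposite.op a • j i w
  t_smul : ∀ i (a : D) w, t i (MulOpposite.op a • w) = MulOpposite.op a • t i w
  j_injective : ∀ i, Function.Injective (j i)
  t_injective : ∀ i, Function.Injective (t i)
  map_j_le : ∀ i x, ((ℰ i).stalk x).map (j i) ≤ (ℰ (i + 1)).stalk x
  map_t_le : ∀ i x, ((ℰ i).stalk x).map (t i) ≤ (ℰ (i + 1)).stalk x
  comm : ∀ i w, j (i + 1) (t i w) = t (i + 1) (j i w)
  /-- The composite map `ℰ_i → ℰ_{i + d deg ∞}` identifies `ℰ_{i + d deg ∞}` with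
  `ℰ_i ⊗ 𝒪_X(∞)`. -/
  periodic : ∀ i x, (ℰ (i + (d * p.deg : ℕ))).stalk x =
    ((ℰ i).twistStalk p x).map (iterMap ℰ j i (d * p.deg))
  /-- The global sections of the skyscraper sheaf `coker j_i` have dimension `d`. -/
  rank_coker_j : ∀ i, Module.rank k (DirectSum (Place 𝔽 F) fun x =>
    (ℰ (i + 1)).stalk x ⧸ (((ℰ i).stalk x).map (j i)).submoduleOf ((ℰ (i + 1)).stalk x)) = d
  /-- The cokernel of `t_i` is supported on `o`, where it is a `k`-vector space of dimension `d` on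
  which `𝒪_{X,o}` acts through `z : 𝒪_{X,o} → 𝔽_o → k`. -/
  map_t_eq : ∀ i x, x ≠ o → ((ℰ i).stalk x).map (t i) = (ℰ (i + 1)).stalk x
  rank_coker_t : ∀ i, Module.rank k
    ((ℰ (i + 1)).stalk o ⧸ (((ℰ i).stalk o).map (t i)).submoduleOf ((ℰ (i + 1)).stalk o)) = d
  coker_t_smul : ∀ i (f : o.ring), ∀ w ∈ (ℰ (i + 1)).stalk o,
    (f : F) • w - z (IsLocalRing.residue o.ring f) • w ∈ ((ℰ i).stalk o).map (t i)

/-- `a` is a uniformizer of the stalk of `𝒟` at `x` (meant for `D_x` a division algebra): a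
generator, on the left and on the right, of the ideal of non-units of `𝒟_x`. -/
def OrderSheaf.IsUniformizerAt (𝒟 : OrderSheaf 𝔽 F D) (x : Place 𝔽 F) (a : 𝒟.stalk x) : Prop :=
  ∀ c : 𝒟.stalk x, (¬ IsUnit c ↔ ∃ e, c = e * a) ∧ (¬ IsUnit c ↔ ∃ e, c = a * e)

namespace EllipticSheaf

variable {d : ℕ} {p o : Place 𝔽 F} {z : o.Residue →ₐ[𝔽] k} (E : EllipticSheaf.{v} 𝒟 d p o z)

/-- The Frobenius `φ` of the generic fibre `N = V_0`, that is `t_0` followed by the inverse of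
`j_0` (an injective linear map between vector spaces over `F ⊗ k` of dimension `d²`, hence
bijective). -/
def φ : (E.ℰ 0).V → (E.ℰ 0).V := fun w => Function.invFun (E.j 0) (E.t 0 w)

/-- `E` is exceptional: `φ ^ deg(o) (M_o) = M_o Π_o`, where `M_o` is the stalk of `ℰ_0` at `o` and
`Π_o` is a uniformizer of `𝒟_o`. -/
def IsExceptional : Prop :=
  ∃ P : 𝒟.stalk o, 𝒟.IsUniformizerAt o P ∧
    E.φ^[o.deg] '' ((E.ℰ 0).stalk o) =
      (fun w => MulOpposite.op (P : D) • w) '' ((E.ℰ 0).stalk o)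

/-- The sections over `U` of the sheaf `𝒜 = End(E)`: the endomorphisms `(ψ_i)` of the restriction
of `E` to `U`, i.e. families of homomorphisms `ψ_i : ℰ_i → ℰ_i` over `U ⊗ k`, compatible with the
action of `𝒟` and with the `j_i` and `t_i`. In particular `E.endSections Set.univ` is `End(E)`. -/
def endSections (U : Set (Place 𝔽 F)) : Subring (∀ i, Module.End k (E.ℰ i).V) where
  carrier := {ψ | (∀ i (a : D) w, ψ i (MulOpposite.op a • w) = MulOpposite.op a • ψ i w) ∧
    (∀ i w, ψ (i + 1) (E.j i w) = E.j i (ψ i w)) ∧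
    (∀ i w, ψ (i + 1) (E.t i w) = E.t i (ψ i w)) ∧
    ∀ i, ∀ x ∈ U, ∀ w ∈ (E.ℰ i).stalk x, ψ i w ∈ (E.ℰ i).stalk x}
  mul_mem' := by
    rintro ψ χ ⟨h1, h2, h3, h4⟩ ⟨g1, g2, g3, g4⟩
    refine ⟨fun i a w => ?_, fun i w => ?_, fun i w => ?_, fun i x hx w hw => ?_⟩
    · simp [h1, g1]
    · simp [h2, g2]
    · simp [h3, g3]
    · exact h4 i x hx _ (g4 i x hx w hw)
  one_mem' := by simp
  add_mem' := by
    rintro ψ χ ⟨h1, h2, h3, h4⟩ ⟨g1, g2, g3, g4⟩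
    refine ⟨fun i a w => ?_, fun i w => ?_, fun i w => ?_, fun i x hx w hw => ?_⟩
    · simp [h1, g1]
    · simp [h2, g2]
    · simp [h3, g3]
    · exact add_mem (h4 i x hx _ hw) (g4 i x hx w hw)
  zero_mem' := by simp
  neg_mem' := by
    rintro ψ ⟨h1, h2, h3, h4⟩
    refine ⟨fun i a w => ?_, fun i w => ?_, fun i w => ?_, fun i x hx w hw => ?_⟩
    · simp [h1]
    · simp [h2]
    · simp [h3]
    · exact neg_mem (h4 i x hx _ hw)

theorem endSections_anti {U U' : Set (Place 𝔽 F)} (h : U' ⊆ U) :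
    E.endSections U ≤ E.endSections U' :=
  fun _ hψ => ⟨hψ.1, hψ.2.1, hψ.2.2.1, fun i x hx => hψ.2.2.2 i x (h hx)⟩

/-- The restriction map `Γ(U, 𝒜) → Γ(U', 𝒜)` for `U' ⊆ U`. -/
def restrict {U U' : Set (Place 𝔽 F)} (h : U' ⊆ U) : E.endSections U →+* E.endSections U' :=
  Subring.inclusion (E.endSections_anti h)

/-- `Aut(E) = Γ(X, 𝒜ˣ)`. -/
abbrev Aut : Type _ := (E.endSections Set.univ)ˣ

/-- `Λ = Γ(X - ∞, 𝒜)`. -/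
abbrev Λ : Type _ := E.endSections {p}ᶜ

/-- The restriction map `Aut(E) → Λˣ`. -/
def autRestrict : E.Aut →* E.Λˣ :=
  Units.map (E.restrict (Set.subset_univ {p}ᶜ)).toMonoidHom

end EllipticSheaf

end Sheaves

end DElliptic

end

open scoped TensorProduct

noncomputable section

namespace DElliptic

section FunctionField

open Polynomial IntermediateField
open scoped IntermediateField.algebraAdjoinAdjoin

variable {𝔽 F : Type*} [Field 𝔽] [Field F] [Algebra 𝔽 F]

theorem IsCurveFunctionField.mem_range_of_isAlgebraic (hF : IsCurveFunctionField 𝔽 F) {f : F}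
    (hf : IsAlgebraic 𝔽 f) : ∃ a : 𝔽, algebraMap 𝔽 F a = f := by
  have : f ∈ algebraicClosure 𝔽 F := mem_algebraicClosure_iff.2 hf
  rwa [hF.algebraicClosure_eq_bot, IntermediateField.mem_bot] at this

theorem IsCurveFunctionField.finiteDimensional_adjoin (hF : IsCurveFunctionField 𝔽 F) {t : F}
    (ht : Transcendental 𝔽 t) : FiniteDimensional 𝔽⟮t⟯ F := by
  have hb : IsTranscendenceBasis 𝔽 (fun _ : Unit => t) :=
    (algebraicIndependent_unique_type_iff.2 ht).isTranscendenceBasis_of_lift_trdeg_le_of_finite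
      (by simp [hF.trdeg_eq_one])
  have h := hb.isAlgebraic_field
  rw [Set.range_const] at h
  have := hF.essFiniteType
  have : Algebra.EssFiniteType 𝔽⟮t⟯ F := .of_comp 𝔽 _ _
  exact Algebra.finite_of_essFiniteType_of_isAlgebraic ..

theorem linearIndependent_adjoin_of_coeff_zero {ι : Type*} {t : F} (ht : t ≠ 0) {x : ι → F}
    (h : ∀ (s : Finset ι) (p : ι → 𝔽[X]), ∑ i ∈ s, aeval t (p i) * x i = 0 →
      ∀ i ∈ s, (p i).coeff 0 = 0) : LinearIndependent 𝔽⟮t⟯ x := by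
  rw [← LinearIndependent.iff_fractionRing (Algebra.adjoin 𝔽 {t}) 𝔽⟮t⟯, linearIndependent_iff']
  intro s g hg
  have hp (i) : ∃ p : 𝔽[X], aeval t p = (g i : F) := by
    simpa [Algebra.adjoin_singleton_eq_range_aeval] using (g i).2
  choose p hp using hp
  have key : ∀ (n : ℕ) (p : ι → 𝔽[X]), ∑ i ∈ s, aeval t (p i) * x i = 0 →
      ∀ i ∈ s, (p i).coeff n = 0 := by
    intro n
    induction n with
    | zero => exact fun p => h s p
    | succ n ih =>
      intro p hp i hi
      rw [← coeff_divX]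
      refine ih (fun i => divX (p i)) ?_ i hi
      refine (mul_eq_zero.1 (?_ : t * _ = 0)).resolve_left ht
      rw [← hp, Finset.mul_sum]
      refine Finset.sum_congr rfl fun i hi => ?_
      conv_rhs => rw [← divX_mul_X_add (p i), h s p hp i hi]
      simp; ring
  intro i hi
  have : p i = 0 := by
    ext n
    refine key n p ?_ i hi
    simpa [hp, Algebra.smul_def] using hg
  ext
  simp [← hp, this]

end FunctionField

namespace Place

open Polynomial IntermediateField

variable {𝔽 F : Type*} [Field 𝔽] [Field F] [Algebra 𝔽 F] (x : Place 𝔽 F)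

theorem valuation_algebraMap {a : 𝔽} (ha : a ≠ 0) : x.ring.valuation (algebraMap 𝔽 F a) = 1 := by
  apply le_antisymm
  · exact (x.ring.valuation_le_one_iff _).2 (x.algebraMap_mem a)
  · have h := (x.ring.valuation_le_one_iff _).2 (x.algebraMap_mem a⁻¹)
    rw [map_inv₀, map_inv₀] at h
    have h0 : x.ring.valuation (algebraMap 𝔽 F a) ≠ 0 := by simpa using ha
    exact (inv_le_one₀ (zero_lt_iff.2 h0)).1 h

theorem exists_valuation_lt_one : ∃ t : F, t ≠ 0 ∧ x.ring.valuation t < 1 := by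
  obtain ⟨t, ht⟩ : ∃ t, t ∉ x.ring := by
    by_contra! h
    exact x.ne_top (by ext; simp [h])
  have h1 : 1 < x.ring.valuation t := by
    rw [← not_le, x.ring.valuation_le_one_iff]; exact ht
  refine ⟨t⁻¹, ?_, ?_⟩
  · rintro h
    simp [inv_eq_zero.1 h] at h1
  · rw [map_inv₀]
    exact inv_lt_one_of_one_lt₀ h1

theorem transcendental_of_valuation_lt_one (hF : IsCurveFunctionField 𝔽 F) {t : F} (h0 : t ≠ 0)
    (ht : x.ring.valuation t < 1) : Transcendental 𝔽 t := by
  intro h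
  obtain ⟨a, rfl⟩ := hF.mem_range_of_isAlgebraic h
  rw [x.valuation_algebraMap (by simpa using h0)] at ht
  exact lt_irrefl _ ht

theorem valuation_aeval_le_one {t : F} (ht : x.ring.valuation t ≤ 1) (p : 𝔽[X]) :
    x.ring.valuation (aeval t p) ≤ 1 := by
  rw [x.ring.valuation_le_one_iff] at ht ⊢
  have : aeval t p = ((aeval (⟨t, ht⟩ : x.ring) p : x.ring) : F) :=
    (aeval_algebraMap_apply F (⟨t, ht⟩ : x.ring) p)
  rw [this]
  exact Subtype.property _

theorem valuation_aeval_le {t : F} (ht : x.ring.valuation t ≤ 1) {p : 𝔽[X]} (hp : p.coeff 0 = 0) :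
    x.ring.valuation (aeval t p) ≤ x.ring.valuation t := by
  rw [← divX_mul_X_add p, hp]
  simpa using mul_le_of_le_one_left' (x.valuation_aeval_le_one ht (divX p))

theorem valuation_aeval_eq_one {t : F} (ht : x.ring.valuation t < 1) {p : 𝔽[X]}
    (hp : p.coeff 0 ≠ 0) : x.ring.valuation (aeval t p) = 1 := by
  rw [← divX_mul_X_add p]
  simp only [map_add, map_mul, aeval_X, aeval_C]
  rw [Valuation.map_add_eq_of_lt_right, x.valuation_algebraMap hp]
  rw [x.valuation_algebraMap hp, map_mul]
  exact lt_of_le_of_lt (mul_le_of_le_one_left' (x.valuation_aeval_le_one ht.le _)) ht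

theorem finite_Ioc_valuation (hF : IsCurveFunctionField 𝔽 F) {t : F} (h0 : t ≠ 0) :
    (Set.Ioc (x.ring.valuation t) 1).Finite := by
  classical
  by_cases ht : x.ring.valuation t < 1
  swap
  · rw [Set.Ioc_eq_empty ht]; exact Set.finite_empty
  have := hF.finiteDimensional_adjoin (x.transcendental_of_valuation_lt_one hF h0 ht)
  choose y hy using x.ring.valuation_surjective
  have hli : LinearIndependent 𝔽⟮t⟯ (fun γ : Set.Ioc (x.ring.valuation t) 1 => y γ) := by
    refine linearIndependent_adjoin_of_coeff_zero h0 fun s p hp => ?_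
    by_contra! hne
    obtain ⟨γ, hγ, hmax⟩ := (s.filter fun γ => (p γ).coeff 0 ≠ 0).exists_max_image id
      (by obtain ⟨i, hi, h⟩ := hne; exact ⟨i, by simp [hi, h]⟩)
    simp only [Finset.mem_filter, id, and_imp] at hγ hmax
    have hv : x.ring.valuation (aeval t (p γ) * y γ) = γ := by
      rw [map_mul, x.valuation_aeval_eq_one ht hγ.2, one_mul, hy]
    have hlt : x.ring.valuation (∑ i ∈ s.erase γ, aeval t (p i) * y i) < γ := by
      refine Valuation.map_sum_lt _ (ne_of_gt (lt_of_le_of_lt zero_le γ.2.1)) fun i hi => ?_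
      rw [Finset.mem_erase] at hi
      rw [map_mul, hy]
      by_cases hc : (p i).coeff 0 = 0
      · calc _ ≤ x.ring.valuation t * 1 :=
              mul_le_mul' (x.valuation_aeval_le ht.le hc) i.2.2
          _ < _ := by simpa using γ.2.1
      · rw [x.valuation_aeval_eq_one ht hc, one_mul]
        exact lt_of_le_of_ne (hmax i hi.2 hc) fun h => hi.1 (Subtype.ext h)
    rw [← Finset.add_sum_erase _ _ hγ.1] at hp
    have := Valuation.map_add_eq_of_lt_left x.ring.valuation (hv.symm ▸ hlt)
    rw [hp, hv, map_zero] at this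
    exact absurd (this ▸ γ.2.1) (not_lt.2 zero_le)
  exact Set.finite_coe_iff.1 hli.finite

theorem deg_pos (hF : IsCurveFunctionField 𝔽 F) : 0 < x.deg := by
  obtain ⟨t, h0, ht⟩ := x.exists_valuation_lt_one
  have := hF.finiteDimensional_adjoin (x.transcendental_of_valuation_lt_one hF h0 ht)
  let b := Module.Basis.ofVectorSpace 𝔽 x.Residue
  choose y hy using IsLocalRing.residue_surjective (R := x.ring)
  have hli : LinearIndependent 𝔽⟮t⟯ (fun i => (y (b i) : F)) := by
    refine linearIndependent_adjoin_of_coeff_zero h0 fun s p hp => ?_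
    let t' : x.ring := ⟨t, (x.ring.valuation_le_one_iff t).1 ht.le⟩
    have ht' : IsLocalRing.residue x.ring t' = 0 := by
      rw [IsLocalRing.residue_eq_zero_iff, x.ring.valuation_lt_one_iff]; exact ht
    have hp' : ∑ i ∈ s, aeval t' (p i) * y (b i) = 0 := by
      apply Subtype.ext
      have : ∀ q : 𝔽[X], ((aeval t' q : x.ring) : F) = aeval t q := fun q =>
        (aeval_algebraMap_apply F t' q).symm
      push_cast
      simpa [this] using hp
    have := congrArg (IsLocalRing.residue x.ring) hp'
    rw [map_sum, map_zero] at this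
    have h2 : ∀ i, IsLocalRing.residue x.ring (aeval t' (p i) * y (b i)) =
        (p i).coeff 0 • b i := by
      intro i
      rw [map_mul, hy, ← divX_mul_X_add (p i)]
      simp only [map_add, map_mul, aeval_X, ht', mul_zero, aeval_C, zero_add]
      simp [Algebra.smul_def]
      left; rfl
    simp only [h2] at this
    exact linearIndependent_iff'.1 b.linearIndependent s _ this
  have := hli.finite
  have : Module.Finite 𝔽 x.Residue := Module.Finite.of_basis b
  exact Module.finrank_pos

/-- `ϖ` generates the maximal ideal of the local ring at `x`. -/
structure IsUniformizer (ϖ : F) : Prop where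
  ne_zero : ϖ ≠ 0
  valuation_lt_one : x.ring.valuation ϖ < 1
  valuation_le : ∀ f : F, x.ring.valuation f < 1 → x.ring.valuation f ≤ x.ring.valuation ϖ

theorem exists_isUniformizer (hF : IsCurveFunctionField 𝔽 F) : ∃ ϖ, x.IsUniformizer ϖ := by
  obtain ⟨t, h0, ht⟩ := x.exists_valuation_lt_one
  have hfin : (Set.Ico (x.ring.valuation t) 1).Finite :=
    ((x.finite_Ioc_valuation hF h0).insert (x.ring.valuation t)).subset fun γ hγ => by
      rcases hγ.1.eq_or_lt with h | h
      · exact Or.inl h.symm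
      · exact Or.inr ⟨h, hγ.2.le⟩
  obtain ⟨γ, hγ, hmax⟩ := hfin.exists_maximal ⟨_, le_rfl, ht⟩
  obtain ⟨ϖ, rfl⟩ := x.ring.valuation_surjective γ
  have h0' : x.ring.valuation t ≠ 0 := by simpa using h0
  refine ⟨ϖ, ?_, hγ.2, fun f hf => ?_⟩
  · rintro rfl
    simp [h0] at hγ
  · rcases le_total (x.ring.valuation f) (x.ring.valuation ϖ) with h | h
    · exact h
    · exact hmax ⟨hγ.1.trans h, hf⟩ h

variable {x} {ϖ : F}

theorem IsUniformizer.valuation_pos (h : x.IsUniformizer ϖ) : 0 < x.ring.valuation ϖ :=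
  zero_lt_iff.2 (by simpa using h.ne_zero)

theorem IsUniformizer.mem (h : x.IsUniformizer ϖ) : ϖ ∈ x.ring :=
  (x.ring.valuation_le_one_iff _).1 h.valuation_lt_one.le

theorem IsUniformizer.inv_mul_mem (h : x.IsUniformizer ϖ) {f : F} (hf : x.ring.valuation f < 1) :
    ϖ⁻¹ * f ∈ x.ring := by
  rw [← x.ring.valuation_le_one_iff, map_mul, map_inv₀, inv_mul_le_iff₀ h.valuation_pos, mul_one]
  exact h.valuation_le f hf

theorem IsUniformizer.exists_pow_lt (h : x.IsUniformizer ϖ) (hF : IsCurveFunctionField 𝔽 F)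
    {f : F} (hf : f ≠ 0) : ∃ n : ℕ, x.ring.valuation ϖ ^ n < x.ring.valuation f := by
  by_contra! hle
  have hanti : StrictAnti fun n : ℕ => x.ring.valuation ϖ ^ n := fun a b hab =>
    pow_lt_pow_right_of_lt_one₀ h.valuation_pos h.valuation_lt_one hab
  refine (Set.infinite_range_of_injective hanti.injective) ?_
  refine (x.finite_Ioc_valuation hF hf).subset ?_
  rintro _ ⟨n, rfl⟩
  exact ⟨(hle (n + 1)).trans_lt (hanti n.lt_succ_self), pow_le_one' h.valuation_lt_one.le n⟩

/-- An element `f` with `ϖ⁻ⁿ f` regular at `x` for all `n` vanishes. -/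
theorem IsUniformizer.eq_zero_of_forall (h : x.IsUniformizer ϖ) (hF : IsCurveFunctionField 𝔽 F)
    {f : F} (hf : ∀ n : ℕ, (ϖ⁻¹) ^ n * f ∈ x.ring) : f = 0 := by
  by_contra h0
  obtain ⟨n, hn⟩ := h.exists_pow_lt hF h0
  have := (x.ring.valuation_le_one_iff _).2 (hf n)
  rw [map_mul, map_pow, map_inv₀, inv_pow, inv_mul_le_iff₀ (pow_pos h.valuation_pos n),
    mul_one] at this
  exact absurd hn (not_lt.2 this)

theorem IsUniformizer.exists_pow_mul_mem (h : x.IsUniformizer ϖ)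
    (hF : IsCurveFunctionField 𝔽 F) (f : F) : ∃ n : ℕ, ∀ m, n ≤ m → ϖ ^ m * f ∈ x.ring := by
  by_cases hf : f = 0
  · exact ⟨0, fun m _ => by simp [hf, x.ring.zero_mem]⟩
  obtain ⟨n, hn⟩ := h.exists_pow_lt hF (inv_ne_zero hf)
  refine ⟨n, fun m hm => ?_⟩
  rw [← x.ring.valuation_le_one_iff, map_mul, map_pow]
  rw [map_inv₀] at hn
  have h1 : x.ring.valuation ϖ ^ m ≤ (x.ring.valuation f)⁻¹ :=
    (pow_le_pow_right_of_le_one' h.valuation_lt_one.le hm).trans hn.le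
  calc _ ≤ (x.ring.valuation f)⁻¹ * x.ring.valuation f := mul_le_mul_left h1 _
    _ = 1 := inv_mul_cancel₀ (by simpa using hf)

/-- A function that is regular everywhere is constant. -/
theorem exists_algebraMap_eq_of_forall_mem (hF : IsCurveFunctionField 𝔽 F) {f : F}
    (hf : ∀ x : Place 𝔽 F, f ∈ x.ring) : ∃ a : 𝔽, algebraMap 𝔽 F a = f := by
  by_contra hne
  have hR : f ∉ (integralClosure 𝔽 F).toSubring := fun h =>
    hne (hF.mem_range_of_isAlgebraic (IsIntegral.isAlgebraic h))
  have : IsIntegrallyClosedIn (integralClosure 𝔽 F).toSubring F :=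
    inferInstanceAs (IsIntegrallyClosedIn (integralClosure 𝔽 F) F)
  obtain ⟨V, hV, hfV⟩ := Subring.exists_le_valuationSubring_of_isIntegrallyClosedIn hR
  refine hfV (hf ⟨V, fun a => hV ?_, ?_⟩)
  · exact isIntegral_algebraMap
  · rintro rfl
    exact hfV (by simp)

end Place

namespace Place

variable {𝔽 F k : Type*} [Field 𝔽] [Field F] [Algebra 𝔽 F] [Field k] [Algebra 𝔽 k]

theorem mem_baseChange_iff {ι : Type*} (b : Module.Basis ι 𝔽 k) (x : Place 𝔽 F) (c : F ⊗[𝔽] k) :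
    c ∈ x.baseChange k ↔ ∀ i, (b.baseChange F).repr c i ∈ x.ring := by
  constructor
  · rintro ⟨c, rfl⟩ i
    induction c using TensorProduct.induction_on with
    | zero => simp
    | add c c' h h' => simpa using x.ring.add_mem _ _ h h'
    | tmul f a =>
      simp only [AlgHom.toRingHom_eq_coe, RingHom.coe_coe, Algebra.TensorProduct.map_tmul,
        Module.Basis.baseChange_repr_tmul, Algebra.smul_def]
      exact x.ring.mul_mem _ _ (x.algebraMap_mem _) f.2
  · intro h
    rw [← (b.baseChange F).linearCombination_repr c, Finsupp.linearCombination_apply]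
    refine sum_mem fun i _ => ⟨⟨_, h i⟩ ⊗ₜ b i, ?_⟩
    simp only [AlgHom.toRingHom_eq_coe, RingHom.coe_coe, Algebra.TensorProduct.map_tmul,
      Module.Basis.baseChange_apply, TensorProduct.smul_tmul', smul_eq_mul, mul_one]
    rfl

/-- A function on `X ⊗ k` that is regular everywhere is constant. -/
theorem exists_tmul_eq_of_forall_mem (hF : IsCurveFunctionField 𝔽 F) {c : F ⊗[𝔽] k}
    (hc : ∀ x : Place 𝔽 F, c ∈ x.baseChange k) : ∃ a : k, (1 : F) ⊗ₜ[𝔽] a = c := by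
  let b := Module.Basis.ofVectorSpace 𝔽 k
  have h (i) : ∃ a : 𝔽, algebraMap 𝔽 F a = (b.baseChange F).repr c i :=
    exists_algebraMap_eq_of_forall_mem hF fun x => (x.mem_baseChange_iff b c).1 (hc x) i
  choose a ha using h
  refine ⟨((b.baseChange F).repr c).sum fun i _ => a i • b i, ?_⟩
  conv_rhs => rw [← (b.baseChange F).linearCombination_repr c, Finsupp.linearCombination_apply]
  rw [Finsupp.sum, Finsupp.sum, TensorProduct.tmul_sum]
  refine Finset.sum_congr rfl fun i _ => ?_
  rw [← ha, Module.Basis.baseChange_apply, TensorProduct.tmul_smul, algebraMap_smul]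

variable {x : Place 𝔽 F} {ϖ : F}

theorem IsUniformizer.eq_zero_of_forall_baseChange (h : x.IsUniformizer ϖ)
    (hF : IsCurveFunctionField 𝔽 F) {c : F ⊗[𝔽] k}
    (hc : ∀ n : ℕ, ((ϖ⁻¹) ^ n) • c ∈ x.baseChange k) : c = 0 := by
  let b := Module.Basis.ofVectorSpace 𝔽 k
  refine (b.baseChange F).ext_elem fun i => ?_
  rw [map_zero, Finsupp.zero_apply]
  refine h.eq_zero_of_forall hF fun n => ?_
  simpa using (x.mem_baseChange_iff b _).1 (hc n) i

theorem IsUniformizer.exists_pow_smul_mem_baseChange (h : x.IsUniformizer ϖ)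
    (hF : IsCurveFunctionField 𝔽 F) (c : F ⊗[𝔽] k) :
    ∃ n : ℕ, ∀ m, n ≤ m → (ϖ ^ m) • c ∈ x.baseChange k := by
  let b := Module.Basis.ofVectorSpace 𝔽 k
  choose n hn using fun f => h.exists_pow_mul_mem hF f
  refine ⟨((b.baseChange F).repr c).support.sup fun i => n ((b.baseChange F).repr c i),
    fun m hm => (x.mem_baseChange_iff b _).2 fun i => ?_⟩
  by_cases hi : (b.baseChange F).repr c i = 0
  · simp [hi, x.ring.zero_mem]
  · simpa using hn _ m (le_trans (Finset.le_sup
      (f := fun i => n ((b.baseChange F).repr c i)) (by simpa using hi)) hm)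

end Place

section BaseField

open Polynomial

variable {𝔽 F k : Type*} [Field 𝔽] [Field F] [Algebra 𝔽 F] [Field k] [Algebra 𝔽 k]

theorem IsCurveFunctionField.irreducible_map (hF : IsCurveFunctionField 𝔽 F) {p : 𝔽[X]}
    (hp : Irreducible p) (hm : p.Monic) : Irreducible (p.map (algebraMap 𝔽 F)) := by
  have hsurj : ∀ c : integralClosure 𝔽 F, ∃ a : 𝔽, algebraMap 𝔽 F a = c := fun c =>
    hF.mem_range_of_isAlgebraic (IsIntegral.isAlgebraic c.2)
  have hlift : ∀ g : F[X], g.Monic → g ∣ p.map (algebraMap 𝔽 F) →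
      ∃ g₀ : 𝔽[X], g₀.map (algebraMap 𝔽 F) = g := by
    intro g hg hd
    have h := integralClosure.mem_lifts_of_monic_of_dvd_map F hm hg hd
    rw [lifts_iff_coeff_lifts] at h
    rw [← mem_lifts, lifts_iff_coeff_lifts]
    intro n
    obtain ⟨c, hc⟩ := h n
    obtain ⟨a, ha⟩ := hsurj c
    exact ⟨a, ha.trans hc⟩
  refine (irreducible_of_monic (hm.map _) fun h => ?_).2 fun f g hf hg hfg => ?_
  · have : p.natDegree = 0 := by
      rw [← natDegree_map (algebraMap 𝔽 F), h, natDegree_one]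
    exact hp.natDegree_pos.ne' this
  · obtain ⟨f₀, rfl⟩ := hlift f hf ⟨g, hfg.symm⟩
    obtain ⟨g₀, rfl⟩ := hlift g hg ⟨_, by rw [← hfg, mul_comm]⟩
    rw [← Polynomial.map_mul] at hfg
    have hfg' := map_injective _ (algebraMap 𝔽 F).injective hfg
    have hf' : f₀.Monic := monic_of_injective (algebraMap 𝔽 F).injective hf
    have hg' : g₀.Monic := monic_of_injective (algebraMap 𝔽 F).injective hg
    rcases (irreducible_of_monic hm hp.ne_one).1 hp f₀ g₀ hf' hg' hfg' with h | h <;> simp [h]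

theorem IsCurveFunctionField.isField_tensorProduct [Finite 𝔽] [Algebra.IsAlgebraic 𝔽 k]
    (hF : IsCurveFunctionField 𝔽 F) : IsField (F ⊗[𝔽] k) := by
  classical
  refine ⟨exists_pair_ne _, mul_comm, fun {c} hc => ?_⟩
  obtain ⟨S, hS⟩ := TensorProduct.exists_finset c
  let k₀ := IntermediateField.adjoin 𝔽 ((S.image Prod.snd : Finset k) : Set k)
  have : FiniteDimensional 𝔽 k₀ :=
    IntermediateField.finiteDimensional_adjoin fun a _ => Algebra.IsIntegral.isIntegral a
  obtain ⟨α, hα⟩ := Field.exists_primitive_element 𝔽 k₀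
  have hαint : IsIntegral 𝔽 α := Algebra.IsIntegral.isIntegral α
  have hrep (a : k) (ha : a ∈ k₀) : ∃ p : 𝔽[X], aeval (α : k) p = a := by
    have h1 : (⟨a, ha⟩ : k₀) ∈ Algebra.adjoin 𝔽 {α} := by
      rw [← IntermediateField.adjoin_simple_toSubalgebra_of_isAlgebraic hαint.isAlgebraic, hα]
      trivial
    rw [Algebra.adjoin_singleton_eq_range_aeval] at h1
    obtain ⟨p, hp⟩ := h1
    refine ⟨p, ?_⟩
    have := congrArg (algebraMap k₀ k) hp
    rw [AlgHom.toRingHom_eq_coe, RingHom.coe_coe, ← aeval_algebraMap_apply] at this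
    exact this
  let θ : F ⊗[𝔽] k := 1 ⊗ₜ (α : k)
  have hθ (p : 𝔽[X]) : aeval θ (p.map (algebraMap 𝔽 F)) = 1 ⊗ₜ aeval (α : k) p := by
    rw [aeval_map_algebraMap]
    exact aeval_algHom_apply (Algebra.TensorProduct.includeRight : k →ₐ[𝔽] F ⊗[𝔽] k) (α : k) p
  have hq : ∃ q : F[X], aeval θ q = c := by
    have h1 : ∀ s ∈ S, ∃ p : 𝔽[X], aeval (α : k) p = s.2 := fun s hs => hrep _
      (IntermediateField.subset_adjoin _ _ (by
        rw [Finset.coe_image]; exact ⟨s, hs, rfl⟩))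
    choose! p hp using h1
    refine ⟨∑ s ∈ S, C s.1 * (p s).map (algebraMap 𝔽 F), ?_⟩
    rw [hS, map_sum]
    refine Finset.sum_congr rfl fun s hs => ?_
    rw [map_mul, hθ, aeval_C, hp s hs]
    simp [Algebra.TensorProduct.algebraMap_apply]
  obtain ⟨q, rfl⟩ := hq
  have hirr := hF.irreducible_map (minpoly.irreducible hαint) (minpoly.monic hαint)
  have hroot : aeval θ ((minpoly 𝔽 α).map (algebraMap 𝔽 F)) = 0 := by
    rw [hθ]
    have : aeval (α : k) (minpoly 𝔽 α) = 0 := by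
      have := aeval_algebraMap_apply k α (minpoly 𝔽 α)
      rwa [minpoly.aeval, map_zero] at this
    rw [this, TensorProduct.tmul_zero]
  have hnd : ¬ (minpoly 𝔽 α).map (algebraMap 𝔽 F) ∣ q := by
    rintro ⟨r, rfl⟩
    rw [map_mul, hroot, zero_mul] at hc
    exact hc rfl
  obtain ⟨u, w, huw⟩ := (hirr.coprime_iff_not_dvd).2 hnd
  refine ⟨aeval θ w, ?_⟩
  have := congrArg (aeval θ) huw
  rw [map_add, map_mul, map_mul, hroot, mul_zero, zero_add, map_one, mul_comm] at this
  exact this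

end BaseField

end DElliptic

end

open scoped TensorProduct

noncomputable section

namespace DElliptic

namespace Place

variable {𝔽 F : Type*} [Field 𝔽] [Field F] [Algebra 𝔽 F] (x : Place 𝔽 F)

theorem valued_algebraMap_completion (f : F) :
    Valued.v (algebraMap F x.Completion f) = x.ring.valuation f :=
  Valued.valuedCompletion_apply (K := WithVal x.ring.valuation) (WithVal.toVal _ f)

theorem exists_valued_sub_lt (y : x.Completion) {γ : x.ring.ValueGroup} (hγ : γ ≠ 0) :
    ∃ f : F, Valued.v (algebraMap F x.Completion f - y) < γ := by
  obtain ⟨g, rfl⟩ := x.ring.valuation_surjective γ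
  have h0 : (Valued.v.restrict (algebraMap F x.Completion g)) ≠ 0 := by
    rw [map_ne_zero] at hγ ⊢
    simpa using hγ
  have hn : {y' | Valued.v.restrict (y' - y) < Valued.v.restrict (algebraMap F x.Completion g)} ∈
      nhds y := Valued.mem_nhds.2 ⟨Units.mk0 _ h0, subset_rfl⟩
  obtain ⟨y', hy', f, rfl⟩ := mem_closure_iff_nhds.1
    (UniformSpace.Completion.denseRange_coe (α := WithVal x.ring.valuation) y) _ hn
  refine ⟨f.ofVal, ?_⟩
  rw [← x.valued_algebraMap_completion g]
  exact Valued.v.restrict_lt_iff.1 hy'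

end Place

section Valuation

variable {C Γ : Type*} [Field C] [LinearOrderedCommGroupWithZero Γ] (w : Valuation C Γ) {d : ℕ}

/-- The lattice generated by finitely many vectors that span `C ^ d` is free: it has a basis
consisting of some of them. -/
theorem exists_matrix_inv_mulVec_le_one {ι : Type*} [Finite ι] (g : ι → Fin d → C)
    (hg : Submodule.span C (Set.range g) = ⊤) :
    ∃ P : Matrix (Fin d) (Fin d) C, IsUnit P.det ∧ (∀ c, ∃ i, P.col c = g i) ∧
      ∀ i r, w ((P⁻¹.mulVec (g i)) r) ≤ 1 := by
  obtain ⟨κ, a, -, hsp, hli⟩ := exists_linearIndependent' C g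
  let b : Module.Basis κ C (Fin d → C) := .mk hli (by rw [hsp, hg])
  have : Finite κ := Module.Finite.finite_basis b
  have := Fintype.ofFinite κ
  have hcard : Fintype.card κ = Fintype.card (Fin d) := by
    rw [← Module.finrank_eq_card_basis b]; simp
  let e := Fintype.equivOfCardEq hcard
  let mat : (Fin d → ι) → Matrix (Fin d) (Fin d) C := fun τ => .of fun r c => g (τ c) r
  have : Nonempty (Fin d → ι) := ⟨a ∘ e.symm⟩
  obtain ⟨τ, hτ⟩ := Finite.exists_max fun τ : Fin d → ι => w (mat τ).det
  have hunit : IsUnit (mat (a ∘ e.symm)).det := by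
    rw [← Matrix.isUnit_iff_isUnit_det, ← Matrix.linearIndependent_cols_iff_isUnit]
    exact hli.comp _ e.symm.injective
  have h0 : 0 < w (mat τ).det :=
    lt_of_lt_of_le (zero_lt_iff.2 (by simpa using hunit.ne_zero)) (hτ (a ∘ e.symm))
  have hdet : (mat τ).det ≠ 0 := by
    intro h
    simp [h] at h0
  refine ⟨mat τ, hdet.isUnit, fun c => ⟨τ c, rfl⟩, fun i r => ?_⟩
  have hcr : (mat τ)⁻¹.mulVec (g i) = (mat τ).det⁻¹ • (mat τ).cramer (g i) := by
    rw [Matrix.cramer_eq_adjugate_mulVec, Matrix.inv_def, Matrix.smul_mulVec, Ring.inverse_eq_inv']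
  have hupd : (mat τ).updateCol r (g i) = mat (Function.update τ r i) := by
    ext s c
    rcases eq_or_ne c r with rfl | hc
    · simp [mat]
    · simp [mat, hc]
  rw [hcr, Pi.smul_apply, Matrix.cramer_apply, hupd, smul_eq_mul, map_mul, map_inv₀,
    inv_mul_le_iff₀ h0, mul_one]
  exact hτ _

theorem matrix_mul_le_one {X Y : Matrix (Fin d) (Fin d) C} (hX : ∀ r c, w (X r c) ≤ 1)
    (hY : ∀ r c, w (Y r c) ≤ 1) (r c : Fin d) : w ((X * Y) r c) ≤ 1 := by
  rw [Matrix.mul_apply]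
  exact w.map_sum_le fun i _ => by rw [map_mul]; exact mul_le_one' (hX _ _) (hY _ _)

theorem matrix_mul_lt_one_left {X Y : Matrix (Fin d) (Fin d) C} (hX : ∀ r c, w (X r c) < 1)
    (hY : ∀ r c, w (Y r c) ≤ 1) (r c : Fin d) : w ((X * Y) r c) < 1 := by
  rw [Matrix.mul_apply]
  exact w.map_sum_lt one_ne_zero fun i _ => by
    rw [map_mul]; exact (mul_le_of_le_one_right' (hY _ _)).trans_lt (hX _ _)

theorem matrix_mul_lt_one_right {X Y : Matrix (Fin d) (Fin d) C} (hX : ∀ r c, w (X r c) ≤ 1)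
    (hY : ∀ r c, w (Y r c) < 1) (r c : Fin d) : w ((X * Y) r c) < 1 := by
  rw [Matrix.mul_apply]
  exact w.map_sum_lt one_ne_zero fun i _ => by
    rw [map_mul]; exact (mul_le_of_le_one_left' (hX _ _)).trans_lt (hY _ _)

theorem matrix_single_le_one (s t r c : Fin d) :
    w ((Matrix.single s t (1 : C)) r c) ≤ 1 := by
  rw [Matrix.single_apply]
  split_ifs <;> simp

end Valuation

section Split

variable {𝔽 F D : Type*} [Field 𝔽] [Field F] [Algebra 𝔽 F] [Ring D] [Algebra F D]
  {x : Place 𝔽 F} {C : Type*} [Field C] [Algebra F C] {w : Valuation C x.ring.ValueGroup} {d : ℕ}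

/-- An `F`-algebra that spans `M_d(C)` is dense in it, if `F` is dense in `C`. -/
theorem exists_entries_sub_lt
    (hdense : ∀ (y : C) (γ : x.ring.ValueGroup), γ ≠ 0 → ∃ f : F, w (algebraMap F C f - y) < γ)
    (ψ : D →ₐ[F] Matrix (Fin d) (Fin d) C) (hψ : Submodule.span C (Set.range ψ) = ⊤)
    (X : Matrix (Fin d) (Fin d) C) :
    ∀ γ : x.ring.ValueGroup, γ ≠ 0 → ∃ a : D, ∀ r c, w ((ψ a - X) r c) < γ := by
  have hX : X ∈ Submodule.span C (Set.range ψ) := hψ ▸ trivial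
  induction hX using Submodule.span_induction with
  | mem X h =>
    obtain ⟨a, rfl⟩ := h
    exact fun γ hγ => ⟨a, fun r c => by simpa using zero_lt_iff.2 hγ⟩
  | zero => exact fun γ hγ => ⟨0, fun r c => by simpa using zero_lt_iff.2 hγ⟩
  | add X Y _ _ hX hY =>
    intro γ hγ
    obtain ⟨a, ha⟩ := hX γ hγ
    obtain ⟨b, hb⟩ := hY γ hγ
    refine ⟨a + b, fun r c => ?_⟩
    have : (ψ (a + b) - (X + Y)) r c = (ψ a - X) r c + (ψ b - Y) r c := by
      simp only [map_add, Matrix.sub_apply, Matrix.add_apply]; ring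
    rw [this]
    exact w.map_add_lt (ha r c) (hb r c)
  | smul y X _ hX =>
    intro γ hγ
    rcases eq_or_ne y 0 with rfl | hy
    · exact ⟨0, fun r c => by simpa using zero_lt_iff.2 hγ⟩
    have hwy : w y ≠ 0 := by simpa using hy
    obtain ⟨a, ha⟩ := hX (γ * (w y)⁻¹) (mul_ne_zero hγ (inv_ne_zero hwy))
    obtain ⟨B, hB0, hB⟩ : ∃ B : x.ring.ValueGroup, B ≠ 0 ∧ ∀ r c, w (ψ a r c) ≤ B := by
      refine ⟨Finset.univ.sup (fun p : Fin d × Fin d => w (ψ a p.1 p.2)) ⊔ 1, ?_, fun r c => ?_⟩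
      · exact ne_of_gt (lt_of_lt_of_le zero_lt_one le_sup_right)
      · exact le_sup_of_le_left
          (Finset.le_sup (f := fun p : Fin d × Fin d => w (ψ a p.1 p.2)) (Finset.mem_univ (r, c)))
    obtain ⟨f, hf⟩ := hdense y (γ * B⁻¹) (mul_ne_zero hγ (inv_ne_zero hB0))
    refine ⟨f • a, fun r c => ?_⟩
    have : (ψ (f • a) - y • X) r c =
        (algebraMap F C f - y) * ψ a r c + y * (ψ a - X) r c := by
      simp only [map_smul, Matrix.sub_apply, Matrix.smul_apply, smul_eq_mul]
      rw [Algebra.smul_def]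
      ring
    rw [this]
    refine w.map_add_lt ?_ ?_
    · rw [map_mul]
      calc _ ≤ w (algebraMap F C f - y) * B := mul_le_mul_right (hB r c) _
        _ < γ * B⁻¹ * B := mul_lt_mul_of_pos_right hf (zero_lt_iff.2 hB0)
        _ = γ := inv_mul_cancel_right₀ hB0 γ
    · rw [map_mul, mul_comm]
      calc _ < γ * (w y)⁻¹ * w y := mul_lt_mul_of_pos_right (ha r c) (zero_lt_iff.2 hwy)
        _ = γ := inv_mul_cancel_right₀ hwy γ

/-- The coordinates with respect to approximate matrix units are bounded by the entries. -/
theorem valuation_coord_le (hw : ∀ f : F, w (algebraMap F C f) = x.ring.valuation f)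
    (ψ : D →ₐ[F] Matrix (Fin d) (Fin d) C) (a : Fin d × Fin d → D)
    (ha : ∀ p r c, w ((ψ (a p) - Matrix.single p.1 p.2 (1 : C)) r c) < 1) (f : Fin d × Fin d → F)
    (p : Fin d × Fin d) :
    ∃ r c, x.ring.valuation (f p) ≤ w (ψ (∑ p, f p • a p) r c) := by
  have : Nonempty (Fin d × Fin d) := ⟨p⟩
  obtain ⟨m, hm⟩ := Finite.exists_max fun p => x.ring.valuation (f p)
  rcases eq_or_ne (f m) 0 with h0 | h0
  · refine ⟨m.1, m.1, (hm p).trans ?_⟩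
    simp [h0]
  refine ⟨m.1, m.2, (hm p).trans (le_of_eq ?_)⟩
  have hsum : ψ (∑ p, f p • a p) m.1 m.2 = algebraMap F C (f m) +
      ∑ p, algebraMap F C (f p) * (ψ (a p) - Matrix.single p.1 p.2 (1 : C)) m.1 m.2 := by
    have : algebraMap F C (f m) =
        ∑ p, algebraMap F C (f p) * (Matrix.single p.1 p.2 (1 : C)) m.1 m.2 := by
      rw [Finset.sum_eq_single m]
      · simp
      · intro q _ hq
        rw [Matrix.single_apply, if_neg, mul_zero]
        exact fun h => hq (Prod.ext h.1 h.2)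
      · simp
    rw [this, ← Finset.sum_add_distrib, map_sum, Matrix.sum_apply]
    refine Finset.sum_congr rfl fun q _ => ?_
    simp only [map_smul, Matrix.smul_apply, Matrix.sub_apply]
    rw [Algebra.smul_def]
    ring
  rw [hsum, w.map_add_eq_of_lt_left, hw]
  rw [hw]
  have hpos : 0 < x.ring.valuation (f m) := zero_lt_iff.2 (by simpa using h0)
  refine w.map_sum_lt hpos.ne' fun q _ => ?_
  rw [map_mul, hw]
  calc _ ≤ x.ring.valuation (f m) * w ((ψ (a q) - Matrix.single q.1 q.2 (1 : C)) m.1 m.2) :=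
        mul_le_mul_left (hm q) _
    _ < x.ring.valuation (f m) * 1 := mul_lt_mul_of_pos_left (ha q _ _) hpos
    _ = _ := mul_one _

/-- The subring of the elements of `D` with integral matrix entries. -/
def integralEntries (w : Valuation C x.ring.ValueGroup)
    (ψ : D →ₐ[F] Matrix (Fin d) (Fin d) C) : Subring D where
  carrier := {a | ∀ r c, w (ψ a r c) ≤ 1}
  mul_mem' ha hb r c := by rw [map_mul]; exact matrix_mul_le_one w ha hb r c
  one_mem' r c := by
    rw [map_one, Matrix.one_apply]
    split_ifs <;> simp
  add_mem' ha hb r c := by rw [map_add]; exact w.map_add_le (ha r c) (hb r c)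
  zero_mem' r c := by simp
  neg_mem' ha r c := by rw [map_neg, Matrix.neg_apply, Valuation.map_neg]; exact ha r c

/-- A stalk of an order can be conjugated into integral matrices. -/
theorem exists_stalk_le_integralEntries [Module.Finite F D] (𝒟 : OrderSheaf 𝔽 F D)
    (hw : ∀ f : F, w (algebraMap F C f) = x.ring.valuation f)
    (ψ : D →ₐ[F] Matrix (Fin d) (Fin d) C) (hψ : Submodule.span C (Set.range ψ) = ⊤) :
    ∃ ψ' : D →ₐ[F] Matrix (Fin d) (Fin d) C, Submodule.span C (Set.range ψ') = ⊤ ∧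
      𝒟.stalk x ≤ integralEntries w ψ' := by
  obtain ⟨b, U, hxU, -, hb⟩ := 𝒟.locallyFree x
  have hbmem (a : D) : a ∈ 𝒟.stalk x ↔ ∀ m, b.repr a m ∈ x.ring := hb x hxU a
  let g : Fin (Module.finrank F D) × Fin d → Fin d → C := fun p => (ψ (b p.1)).col p.2
  have hcol (a : D) (i : Fin d) : (ψ a).col i = ∑ m, algebraMap F C (b.repr a m) • g (m, i) := by
    ext r
    conv_lhs => rw [← b.sum_repr a]
    simp only [g, map_sum, map_smul, Matrix.col_apply, Matrix.sum_apply, Matrix.smul_apply,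
      Finset.sum_apply, Pi.smul_apply, algebraMap_smul]
  have hg : Submodule.span C (Set.range g) = ⊤ := by
    rw [← top_le_iff, ← (Pi.basisFun C (Fin d)).span_eq, Submodule.span_le]
    rintro _ ⟨i, rfl⟩
    have : Pi.basisFun C (Fin d) i = (ψ 1).col i := by
      ext r
      simp [Matrix.one_apply, Pi.single_apply]
    rw [this, hcol]
    exact Submodule.sum_mem _ fun m _ => Submodule.smul_mem _ _ (Submodule.subset_span ⟨_, rfl⟩)
  obtain ⟨P, hP, hPcol, hint⟩ := exists_matrix_inv_mulVec_le_one w g hg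
  have hPinv : P * P⁻¹ = 1 := Matrix.mul_nonsing_inv P hP
  have hPinv' : P⁻¹ * P = 1 := Matrix.nonsing_inv_mul P hP
  let ψ' : D →ₐ[F] Matrix (Fin d) (Fin d) C := AlgHom.ofLinearMap
    ((LinearMap.mulLeftRight F (P⁻¹, P)).comp ψ.toLinearMap) (by simp [hPinv'])
    (fun a c => by
      simp only [LinearMap.comp_apply, AlgHom.toLinearMap_apply, LinearMap.mulLeftRight_apply,
        map_mul]
      rw [show P⁻¹ * ψ a * P * (P⁻¹ * ψ c * P) = P⁻¹ * ψ a * (P * P⁻¹) * ψ c * P by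
        simp only [mul_assoc], hPinv, mul_one]
      simp only [mul_assoc])
  have hψ' (a : D) : ψ' a = P⁻¹ * ψ a * P := rfl
  refine ⟨ψ', ?_, fun a ha r c => ?_⟩
  · rw [← top_le_iff]
    intro X _
    have hX : P * X * P⁻¹ ∈ Submodule.span C (Set.range ψ) := hψ ▸ trivial
    have h2 := Submodule.mem_map_of_mem (f := LinearMap.mulLeftRight C (P⁻¹, P)) hX
    rw [Submodule.map_span, ← Set.range_comp] at h2
    have h3 : LinearMap.mulLeftRight C (P⁻¹, P) (P * X * P⁻¹) = X := by
      rw [LinearMap.mulLeftRight_apply]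
      rw [show P⁻¹ * (P * X * P⁻¹) * P = (P⁻¹ * P) * X * (P⁻¹ * P) by simp only [mul_assoc],
        hPinv', one_mul, mul_one]
    rw [h3] at h2
    exact h2
  · obtain ⟨⟨m, i⟩, hmi⟩ := hPcol c
    have hab : a * b m ∈ 𝒟.stalk x := by
      refine mul_mem ha ((hbmem _).2 fun l => ?_)
      rw [b.repr_self, Finsupp.single_apply]
      split_ifs
      exacts [x.ring.one_mem, x.ring.zero_mem]
    have hentry : ψ' a r c = ∑ l, algebraMap F C (b.repr (a * b m) l) *
        (P⁻¹.mulVec (g (l, i))) r := by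
      have h1 : ψ' a r c = (P⁻¹.mulVec ((ψ (a * b m)).col i)) r := by
        have h2 : (ψ (a * b m)).col i = (ψ a).mulVec (P.col c) := by
          rw [hmi, map_mul]
          rfl
        rw [h2, Matrix.mulVec_mulVec, hψ']
        rfl
      rw [h1, hcol, Matrix.mulVec_sum, Finset.sum_apply]
      simp only [Matrix.mulVec_smul, Pi.smul_apply, smul_eq_mul]
    rw [hentry]
    refine w.map_sum_le fun l _ => ?_
    rw [map_mul, hw]
    exact mul_le_one' ((x.ring.valuation_le_one_iff _).2 ((hbmem _).1 hab l)) (hint _ _)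

theorem OrderSheaf.IsMaximal.exists_matrixUnits_of_algHom [Module.Finite F D]
    {𝒟 : OrderSheaf 𝔽 F D} (h𝒟 : 𝒟.IsMaximal) (hd : Module.finrank F D = d ^ 2)
    (hw : ∀ f : F, w (algebraMap F C f) = x.ring.valuation f)
    (hdense : ∀ (y : C) (γ : x.ring.ValueGroup), γ ≠ 0 → ∃ f : F, w (algebraMap F C f - y) < γ)
    (ψ₀ : D →ₐ[F] Matrix (Fin d) (Fin d) C) (hψ₀ : Submodule.span C (Set.range ψ₀) = ⊤)
    {ϖ : F} (hϖ : x.IsUniformizer ϖ) :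
    ∃ a : Fin d → Fin d → D, (∀ s t, a s t ∈ 𝒟.stalk x) ∧
      (∀ s t s' t', ∃ e ∈ 𝒟.stalk x,
        a s t * a s' t' - (if t = s' then a s t' else 0) = ϖ • e) ∧
      ∃ e ∈ 𝒟.stalk x, 1 - ∑ s, a s s = ϖ • e := by
  classical
  obtain ⟨ψ, hψ, hle⟩ := exists_stalk_le_integralEntries 𝒟 hw ψ₀ hψ₀
  choose a ha using fun p : Fin d × Fin d => exists_entries_sub_lt
    hdense ψ hψ (Matrix.single p.1 p.2 1) 1 one_ne_zero
  have hcoord := valuation_coord_le hw ψ a ha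
  have hli : LinearIndependent F a := by
    rw [Fintype.linearIndependent_iff]
    intro f hf p
    obtain ⟨r, c, h⟩ := hcoord f p
    rw [hf] at h
    simpa using h
  have hspan : Submodule.span F (Set.range a) = ⊤ :=
    hli.span_eq_top_of_card_eq_finrank' (by simp [hd, sq])
  let B : Module.Basis (Fin d × Fin d) F D := .mk hli hspan.ge
  have hB (c : D) : ∑ p, B.repr c p • a p = c := by
    conv_rhs => rw [← B.sum_repr c]
    simp [B]
  have hone (p : Fin d × Fin d) (r c : Fin d) : w (ψ (a p) r c) ≤ 1 := by
    have : ψ (a p) r c = (ψ (a p) - Matrix.single p.1 p.2 (1 : C)) r c +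
        (Matrix.single p.1 p.2 (1 : C)) r c := by simp
    rw [this]
    exact w.map_add_le (ha p r c).le (matrix_single_le_one _ _ _ _ _)
  have hS : integralEntries w ψ = 𝒟.stalk x := by
    refine h𝒟 x _ ⟨⟨Submodule.span x.ring (Set.range a),
      Submodule.fg_span (Set.finite_range a), ?_⟩, ?_⟩ hle
    · ext c
      constructor
      · intro hc
        induction hc using Submodule.span_induction with
        | mem y h => obtain ⟨p, rfl⟩ := h; exact hone p
        | zero => exact zero_mem _
        | add y y' _ _ h h' => exact add_mem (S := Subring D) h h'
        | smul f y _ h =>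
          intro r s
          have : f • y = (f : F) • y := rfl
          rw [this, map_smul, Matrix.smul_apply, Algebra.smul_def, map_mul, hw]
          exact mul_le_one' (x.ring.valuation_le_one f) (h r s)
      · intro hc
        rw [SetLike.mem_coe, ← hB c]
        refine Submodule.sum_mem _ fun p _ => ?_
        have hp : B.repr c p ∈ x.ring := by
          obtain ⟨r, s, h⟩ := hcoord (B.repr c) p
          rw [hB] at h
          exact (x.ring.valuation_le_one_iff _).1 (h.trans (hc r s))
        exact Submodule.smul_mem _ (⟨_, hp⟩ : x.ring) (Submodule.subset_span ⟨p, rfl⟩)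
    · rw [← top_le_iff, ← hspan]
      refine Submodule.span_mono ?_
      rintro _ ⟨p, rfl⟩
      exact hone p
  have hmem (p) : a p ∈ 𝒟.stalk x := by rw [← hS]; exact hone p
  have hdvd (c : D) (hc : ∀ r s, w (ψ c r s) < 1) : ∃ e ∈ 𝒟.stalk x, c = ϖ • e := by
    refine ⟨∑ p, (ϖ⁻¹ * B.repr c p) • a p, sum_mem fun p _ => ?_, ?_⟩
    · obtain ⟨r, s, h⟩ := hcoord (B.repr c) p
      rw [hB] at h
      rw [Algebra.smul_def]
      exact mul_mem (𝒟.algebraMap_mem x _ (hϖ.inv_mul_mem (h.trans_lt (hc r s)))) (hmem p)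
    · rw [Finset.smul_sum]
      conv_lhs => rw [← hB c]
      refine Finset.sum_congr rfl fun p _ => ?_
      rw [smul_smul, mul_inv_cancel_left₀ hϖ.ne_zero]
  refine ⟨fun s t => a (s, t), fun s t => hmem _, fun s t s' t' => hdvd _ fun r c => ?_,
    hdvd _ fun r c => ?_⟩
  · have hprod : ψ (a (s, t) * a (s', t') - if t = s' then a (s, t') else 0) =
        (ψ (a (s, t)) - Matrix.single s t 1) * ψ (a (s', t')) +
        Matrix.single s t 1 * (ψ (a (s', t')) - Matrix.single s' t' 1) -
        (if t = s' then ψ (a (s, t')) - Matrix.single s t' 1 else 0) := by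
      split_ifs with h
      · subst h
        simp only [map_sub, map_mul, sub_mul, mul_sub, Matrix.single_mul_single_same, mul_one]
        abel
      · simp [sub_mul, mul_sub, Matrix.single_mul_single_of_ne _ _ _ _ h]
    rw [hprod]
    refine w.map_sub_lt (w.map_add_lt ?_ ?_) ?_
    · exact matrix_mul_lt_one_left _ (ha (s, t)) (hone _) r c
    · exact matrix_mul_lt_one_right _ (matrix_single_le_one _ s t) (ha (s', t')) r c
    · split_ifs
      · exact ha (s, t') r c
      · simp
  · have hsum : ψ (1 - ∑ s, a (s, s)) = - ∑ s, (ψ (a (s, s)) - Matrix.single s s 1) := by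
      rw [map_sub, map_one, map_sum, Finset.sum_sub_distrib, neg_sub]
      congr 1
      exact (Matrix.sum_single_one).symm
    rw [hsum, Matrix.neg_apply, Valuation.map_neg, Matrix.sum_apply]
    exact w.map_sum_lt one_ne_zero fun s _ => ha (s, s) r c

/-- The stalk of a maximal order at a split place contains elements that are matrix units
modulo a uniformizer. -/
theorem OrderSheaf.IsMaximal.exists_matrixUnits [Module.Finite F D] {𝒟 : OrderSheaf 𝔽 F D}
    (h𝒟 : 𝒟.IsMaximal) (hd : Module.finrank F D = d ^ 2) (hsplit : x.IsSplit D d) {ϖ : F}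
    (hϖ : x.IsUniformizer ϖ) :
    ∃ a : Fin d → Fin d → D, (∀ s t, a s t ∈ 𝒟.stalk x) ∧
      (∀ s t s' t', ∃ e ∈ 𝒟.stalk x,
        a s t * a s' t' - (if t = s' then a s t' else 0) = ϖ • e) ∧
      ∃ e ∈ 𝒟.stalk x, 1 - ∑ s, a s s = ϖ • e := by
  obtain ⟨iso⟩ := hsplit
  let ψ₀ : D →ₐ[F] Matrix (Fin d) (Fin d) x.Completion :=
    (iso.toAlgHom.restrictScalars F).comp Algebra.TensorProduct.includeRight
  have hψ₀ : Submodule.span x.Completion (Set.range ψ₀) = ⊤ := by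
    rw [← top_le_iff]
    intro X _
    obtain ⟨y, rfl⟩ := iso.surjective X
    induction y using TensorProduct.induction_on with
    | zero => simp
    | add y y' h h' => rw [map_add]; exact add_mem (h trivial) (h' trivial)
    | tmul c a =>
      have : c ⊗ₜ[F] a = c • ((1 : x.Completion) ⊗ₜ[F] a) := by simp [TensorProduct.smul_tmul']
      rw [this, map_smul]
      exact Submodule.smul_mem _ _ (Submodule.subset_span ⟨a, rfl⟩)
  exact h𝒟.exists_matrixUnits_of_algHom hd x.valued_algebraMap_completion
    (fun y γ hγ => x.exists_valued_sub_lt y hγ) ψ₀ hψ₀ hϖ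

end Split

end DElliptic

end

open scoped TensorProduct

noncomputable section

namespace DElliptic

section CentralSimple

variable {F D K : Type*} [Field F] [DivisionRing D] [Algebra F D] [Algebra.IsCentral F D]
  [Field K] [Algebra F K]

variable (F D K) in
theorem isSimpleRing_tensorProduct : IsSimpleRing (D ⊗[F] K) := by
  classical
  let β := (Module.Basis.ofVectorSpace F K).baseChange D
  have hl (c : D) (x : D ⊗[F] K) (i) : β.repr ((c ⊗ₜ 1) * x) i = c * β.repr x i := by
    have : (c ⊗ₜ[F] (1 : K)) * x = c • x := by
      induction x using TensorProduct.induction_on with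
      | zero => simp
      | add x y hx hy => rw [mul_add, hx, hy, smul_add]
      | tmul a b => simp [TensorProduct.smul_tmul']
    rw [this, map_smul, Finsupp.smul_apply, smul_eq_mul]
  have hr (c : D) (x : D ⊗[F] K) (i) : β.repr (x * (c ⊗ₜ 1)) i = β.repr x i * c := by
    induction x using TensorProduct.induction_on with
    | zero => simp
    | add x y hx hy => rw [add_mul, map_add, Finsupp.add_apply, hx, hy, map_add,
        Finsupp.add_apply, add_mul]
    | tmul a b => simp [β]
  have key : ∀ n : ℕ, ∀ (I : TwoSidedIdeal (D ⊗[F] K)) (x : D ⊗[F] K), x ∈ I → x ≠ 0 →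
      (β.repr x).support.card ≤ n → (1 : D ⊗[F] K) ∈ I := by
    intro n
    induction n with
    | zero =>
      intro I x _ h0 hn
      simp at hn
      exact absurd hn h0
    | succ n ih =>
      intro I x hx h0 hn
      obtain ⟨i, hi⟩ : ∃ i, β.repr x i ≠ 0 := by
        by_contra! h
        exact h0 (β.ext_elem fun i => by simp [h i])
      let y := ((β.repr x i)⁻¹ ⊗ₜ[F] (1 : K)) * x
      have hy : y ∈ I := I.mul_mem_left _ _ hx
      have hyi : β.repr y i = 1 := by rw [hl, inv_mul_cancel₀ hi]
      have hsupp : (β.repr y).support ⊆ (β.repr x).support := by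
        intro j hj
        rw [Finsupp.mem_support_iff] at hj ⊢
        intro h
        rw [hl, h, mul_zero] at hj
        exact hj rfl
      by_cases hcomm : ∀ (c : D) j, c * β.repr y j = β.repr y j * c
      · have hcen (j) : ∃ f : F, algebraMap F D f = β.repr y j := by
          have : β.repr y j ∈ Subalgebra.center F D :=
            Subalgebra.mem_center_iff.2 fun c => hcomm c j
          rw [Algebra.IsCentral.center_eq_bot F D, Algebra.mem_bot] at this
          exact this
        choose f hf using hcen
        obtain ⟨κ, hκ⟩ : ∃ κ : K, y = 1 ⊗ₜ κ := by
          refine ⟨(β.repr y).sum fun j _ => f j • Module.Basis.ofVectorSpace F K j, ?_⟩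
          conv_lhs => rw [← β.linearCombination_repr y, Finsupp.linearCombination_apply]
          rw [Finsupp.sum, Finsupp.sum, TensorProduct.tmul_sum]
          refine Finset.sum_congr rfl fun j _ => ?_
          rw [← hf, Module.Basis.baseChange_apply, TensorProduct.tmul_smul, algebraMap_smul]
        have hκ0 : κ ≠ 0 := by
          rintro rfl
          rw [hκ, TensorProduct.tmul_zero, map_zero] at hyi
          exact zero_ne_one hyi
        have := I.mul_mem_left (1 ⊗ₜ κ⁻¹) _ hy
        rwa [hκ, Algebra.TensorProduct.tmul_mul_tmul, one_mul, inv_mul_cancel₀ hκ0] at this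
      · push Not at hcomm
        obtain ⟨c, j, hj⟩ := hcomm
        let u := (c ⊗ₜ[F] (1 : K)) * y - y * (c ⊗ₜ[F] (1 : K))
        have hu (l) : β.repr u l = c * β.repr y l - β.repr y l * c := by
          rw [map_sub, Finsupp.sub_apply, hl, hr]
        refine ih I u (I.sub_mem (I.mul_mem_left _ _ hy) (I.mul_mem_right _ _ hy)) ?_ ?_
        · intro h
          have := hu j
          rw [h, map_zero, Finsupp.zero_apply] at this
          exact hj (sub_eq_zero.1 this.symm)
        · have : (β.repr u).support ⊆ (β.repr x).support.erase i := by
            intro l hl'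
            rw [Finsupp.mem_support_iff, hu] at hl'
            rw [Finset.mem_erase]
            constructor
            · rintro rfl
              rw [hyi] at hl'
              simp at hl'
            · refine hsupp ?_
              rw [Finsupp.mem_support_iff]
              intro h
              rw [h] at hl'
              simp at hl'
          refine (Finset.card_le_card this).trans ?_
          rw [Finset.card_erase_of_mem (by rwa [Finsupp.mem_support_iff])]
          omega
  refine ⟨⟨fun I => ?_⟩⟩
  rw [or_iff_not_imp_left]
  intro hI
  obtain ⟨x, hx, h0⟩ : ∃ x ∈ I, x ≠ 0 := by
    by_contra! h
    exact hI (le_bot_iff.1 fun x hx => by simpa using h x hx)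
  rw [← TwoSidedIdeal.one_mem_iff]
  exact key _ I x hx h0 le_rfl

end CentralSimple

section MatrixModule

variable {K Δ P : Type*} [Field K] [DivisionRing Δ] [Algebra K Δ] [AddCommGroup P] [Module K P]

/-- The dimension of a module over `M_n(Δ)` is divisible by the one of the simple module `Δ ^ n`. -/
theorem mul_finrank_dvd_of_matrix [Module.Finite K Δ] [Module.Finite K P] {n : ℕ} [NeZero n]
    (ρ : Matrix (Fin n) (Fin n) Δ →ₐ[K] Module.End K P) :
    n * Module.finrank K Δ ∣ Module.finrank K P := by
  classical
  let : Module Δ P := Module.compHom P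
    ((ρ : Matrix (Fin n) (Fin n) Δ →+* Module.End K P).comp (Matrix.scalar (Fin n)))
  have hsmul (c : Δ) (w : P) : c • w = ρ (Matrix.scalar (Fin n) c) w := rfl
  have : IsScalarTower K Δ P := ⟨fun a c w => by
    rw [hsmul, hsmul]
    have : Matrix.scalar (Fin n) (a • c) = a • Matrix.scalar (Fin n) c := by
      ext i j
      simp only [Matrix.scalar_apply, Matrix.diagonal_apply, Matrix.smul_apply]
      split_ifs <;> simp
    rw [this, map_smul, LinearMap.smul_apply]⟩
  let E (i j : Fin n) : P →ₗ[Δ] P :=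
    { toFun := ρ (Matrix.single i j 1)
      map_add' := map_add _
      map_smul' := fun c w => by
        rw [hsmul, hsmul, RingHom.id_apply, ← Module.End.mul_apply, ← Module.End.mul_apply,
          ← map_mul, ← map_mul]
        congr 2
        ext r l
        simp only [Matrix.scalar_apply, Matrix.mul_diagonal, Matrix.diagonal_mul,
          Matrix.single_apply]
        split_ifs <;> simp }
  have hE (i j : Fin n) (w : P) : E i j w = ρ (Matrix.single i j 1) w := rfl
  have hEE (i j l : Fin n) (w : P) : E i j (E j l w) = E i l w := by
    rw [hE, hE, hE, ← Module.End.mul_apply, ← map_mul, Matrix.single_mul_single_same, one_mul]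
  have hEE' (i j j' l : Fin n) (h : j ≠ j') (w : P) : E i j (E j' l w) = 0 := by
    rw [hE, hE, ← Module.End.mul_apply, ← map_mul, Matrix.single_mul_single_of_ne _ _ _ _ h,
      map_zero, LinearMap.zero_apply]
  have hsum (w : P) : ∑ i, E i i w = w := by
    simp only [hE]
    rw [← LinearMap.sum_apply, ← map_sum, Matrix.sum_single_one, map_one, Module.End.one_apply]
  let Q := LinearMap.range (E 0 0)
  have hQ (q : Q) : E 0 0 (q : P) = q := by
    obtain ⟨_, w, rfl⟩ := q
    exact hEE 0 0 0 w
  let e : P ≃ₗ[Δ] (Fin n → Q) :=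
    { toFun := fun w i => ⟨E 0 i w, E 0 i w, hEE 0 0 i w⟩
      map_add' := fun w w' => by ext; simp
      map_smul' := fun c w => by ext; simp
      invFun := fun q => ∑ i, E i 0 (q i)
      left_inv := fun w => by simpa only [hEE] using hsum w
      right_inv := fun q => by
        ext i
        simp only [map_sum]
        rw [Finset.sum_eq_single i (fun j _ hj => hEE' _ _ _ _ hj.symm _) (by simp), hEE, hQ] }
  have : Module.Finite Δ P := Module.Finite.of_restrictScalars_finite K Δ P
  have hfin : Module.finrank Δ P = n * Module.finrank Δ Q := by
    rw [e.finrank_eq, Module.finrank_pi_fintype]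
    simp
  rw [← Module.finrank_mul_finrank K Δ P, hfin]
  exact ⟨Module.finrank Δ Q, by ring⟩

end MatrixModule

section Division

variable {F D K : Type*} [Field F] [DivisionRing D] [Algebra F D] [Algebra.IsCentral F D]
  [FiniteDimensional F D] [Field K] [Algebra F K]

/-- The length `m` of `D ⊗ K` as a module over itself divides the degree `d` of `D`, and the
dimension of every module over `D ⊗ K` is a multiple of `d² / m`. -/
theorem exists_dvd_finrank_of_central {d : ℕ} (hd : Module.finrank F D = d ^ 2) :
    ∃ m e : ℕ, m ∣ d ∧ m ^ 2 * e = d ^ 2 ∧ ∀ (P : Type*) [AddCommGroup P] [Module F P]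
      [Module K P] [IsScalarTower F K P] [Module.Finite K P] (_ : D →ₐ[F] Module.End K P),
      m * e ∣ Module.finrank K P := by
  have : IsSimpleRing (K ⊗[F] D) := by
    have := isSimpleRing_tensorProduct F D K
    exact IsSimpleRing.of_ringEquiv (Algebra.TensorProduct.comm F D K).toRingEquiv this
  have : IsArtinianRing (K ⊗[F] D) := IsArtinianRing.of_finite K _
  obtain ⟨m, hm, Δ, _, _, _, ⟨iso⟩⟩ :=
    IsSimpleRing.exists_algEquiv_matrix_divisionRing_finite K (K ⊗[F] D)
  have hdim : m ^ 2 * Module.finrank K Δ = d ^ 2 := by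
    rw [← hd, ← Module.finrank_baseChange (R := K) (S := F), iso.toLinearEquiv.finrank_eq,
      Module.finrank_matrix]
    simp [sq]
  refine ⟨m, Module.finrank K Δ, ?_, hdim, fun P _ _ _ _ _ g => ?_⟩
  · rw [← Nat.pow_dvd_pow_iff two_ne_zero]
    exact ⟨_, hdim.symm⟩
  · exact mul_finrank_dvd_of_matrix ((Algebra.TensorProduct.lift
      (Algebra.ofId K (Module.End K P)) g fun a c => Algebra.commutes a (g c)).comp
        iso.symm.toAlgHom)

end Division

end DElliptic

end

open scoped TensorProduct

noncomputable section

namespace DElliptic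

section Layer

open MulOpposite

variable {k D N : Type*} [Field k] [Ring D] [AddCommGroup N] [Module k N] [Module Dᵐᵒᵖ N]
  [SMulCommClass k Dᵐᵒᵖ N] {d : ℕ}

/-- The elements `a s t` of `D` act as matrix units on the quotient `M / M'`, which has dimension
at most `d`. -/
structure IsMatrixLayer (a : Fin d → Fin d → D) (M' M : Submodule k N) : Prop where
  le : M' ≤ M
  smul_mem : ∀ s t, ∀ w ∈ M, op (a s t) • w ∈ M
  smul_mem' : ∀ s t, ∀ w ∈ M', op (a s t) • w ∈ M'
  smul_smul : ∀ s t s' t', ∀ w ∈ M,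
    op (a s' t') • op (a s t) • w - (if t = s' then op (a s t') • w else 0) ∈ M'
  sum_smul : ∀ w ∈ M, w - ∑ s, op (a s s) • w ∈ M'
  dependent : ∀ v : Fin (d + 1) → N, (∀ l, v l ∈ M) → ∃ c : Fin (d + 1) → k, c ≠ 0 ∧
    ∑ l, c l • v l ∈ M'

namespace IsMatrixLayer

variable {a : Fin d → Fin d → D} {M' M : Submodule k N}

theorem exists_generator (h : IsMatrixLayer a M' M) {Q : Submodule k N} (hQM : Q ≤ M)
    (hQ : ∀ s t, ∀ w ∈ Q, op (a s t) • w ∈ Q) {w : N} (hw : w ∈ Q) (hw' : w ∉ M') :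
    ∃ (s : Fin d) (u : N), u ∈ Q ∧ u ∉ M' ∧ op (a s s) • u - u ∈ M' ∧
      ∀ v ∈ M, ∃ c : Fin d → k, v - ∑ t, c t • op (a s t) • u ∈ M' := by
  have := SMulCommClass.symm k Dᵐᵒᵖ N
  obtain ⟨s, hs⟩ : ∃ s, op (a s s) • w ∉ M' := by
    by_contra! hall
    refine hw' ?_
    have := add_mem (h.sum_smul w (hQM hw)) (sum_mem fun s (_ : s ∈ Finset.univ) => hall s)
    rwa [sub_add_cancel] at this
  have hidem : op (a s s) • op (a s s) • w - op (a s s) • w ∈ M' := by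
    simpa using h.smul_smul s s s s w (hQM hw)
  refine ⟨s, op (a s s) • w, hQ s s w hw, hs, hidem, fun v hv => ?_⟩
  set u := op (a s s) • w with hu
  have huM : u ∈ M := h.smul_mem _ _ _ (hQM hw)
  obtain ⟨c, hc0, hc⟩ := h.dependent (Fin.cons v fun t => op (a s t) • u) (by
    intro l
    refine Fin.cases ?_ (fun t => ?_) l
    · exact hv
    · exact h.smul_mem _ _ _ huM)
  rw [Fin.sum_univ_succ] at hc
  simp only [Fin.cons_zero, Fin.cons_succ] at hc
  have hc0' : c 0 ≠ 0 := by
    intro h0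
    rw [h0, zero_smul, zero_add] at hc
    refine hc0 (funext fun l => ?_)
    refine Fin.cases h0 (fun t => ?_) l
    by_contra hct
    have h1 := h.smul_mem' t s _ hc
    rw [Finset.smul_sum] at h1
    have h2 : ∑ t', c t'.succ • (op (a t s) • op (a s t') • u -
        (if t' = t then op (a s s) • u else 0)) ∈ M' :=
      sum_mem fun t' _ => M'.smul_mem _ (h.smul_smul s t' t s u huM)
    simp only [smul_sub, Finset.sum_sub_distrib, smul_ite, smul_zero] at h2
    rw [Finset.sum_ite_eq' Finset.univ t] at h2
    simp only [smul_comm (op (a t s)) (c _)] at h1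
    have h3 : c t.succ • op (a s s) • u ∈ M' := by
      have := sub_mem h1 h2
      simpa using this
    have h4 : c t.succ • u ∈ M' := by
      have := sub_mem h3 (M'.smul_mem (c t.succ) hidem)
      rwa [smul_sub, sub_sub_cancel] at this
    exact hs ((M'.smul_mem_iff hct).1 h4)
  refine ⟨fun t => -((c 0)⁻¹ * c t.succ), ?_⟩
  have := M'.smul_mem (c 0)⁻¹ hc
  rw [smul_add, _root_.smul_smul, inv_mul_cancel₀ hc0', one_smul, Finset.smul_sum] at this
  simpa only [neg_smul, Finset.sum_neg_distrib, sub_neg_eq_add, mul_smul] using this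

/-- The quotient of a matrix layer is a simple module. -/
theorem le_of_mem_of_notMem (h : IsMatrixLayer a M' M) {Q : Submodule k N} (hQ' : M' ≤ Q)
    (hQM : Q ≤ M) (hQ : ∀ s t, ∀ w ∈ Q, op (a s t) • w ∈ Q) {w : N} (hw : w ∈ Q)
    (hw' : w ∉ M') : M ≤ Q := by
  obtain ⟨s, u, huQ, -, -, hgen⟩ := h.exists_generator hQM hQ hw hw'
  intro v hv
  obtain ⟨c, hc⟩ := hgen v hv
  have := add_mem (hQ' hc) (sum_mem fun t (_ : t ∈ Finset.univ) =>
    Q.smul_mem (c t) (hQ s t u huQ))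
  rwa [sub_add_cancel] at this

/-- A linear map that kills one non-zero element of a matrix layer kills all of it. -/
theorem map_mem (h : IsMatrixLayer a M' M) {f : Module.End k N}
    (hf : ∀ (c : D) w, f (op c • w) = op c • f w) {L : Submodule k N}
    (hL : ∀ s t, ∀ w ∈ L, op (a s t) • w ∈ L) (hM' : ∀ w ∈ M', f w ∈ L) {w : N} (hw : w ∈ M)
    (hw' : w ∉ M') (hfw : f w ∈ L) {v : N} (hv : v ∈ M) : f v ∈ L := by
  refine (h.le_of_mem_of_notMem (Q := M ⊓ L.comap f) (le_inf h.le hM') inf_le_left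
    (fun s t w hw => ⟨h.smul_mem s t w hw.1, ?_⟩) ⟨hw, hfw⟩ hw' hv).2
  change f _ ∈ L
  rw [hf]
  exact hL s t _ hw.2

/-- Schur's lemma for a matrix layer. -/
theorem exists_sub_smul_mem (h : IsMatrixLayer a M' M) {f : Module.End k N}
    (hf : ∀ (c : D) w, f (op c • w) = op c • f w) (hM : ∀ w ∈ M, f w ∈ M)
    (hM' : ∀ w ∈ M', f w ∈ M') : ∃ c : k, ∀ w ∈ M, f w - c • w ∈ M' := by
  have := SMulCommClass.symm k Dᵐᵒᵖ N
  by_cases hle : M ≤ M'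
  · exact ⟨0, fun w hw => hle (by simpa using hM w hw)⟩
  obtain ⟨w, hw, hw'⟩ := Set.not_subset.1 hle
  obtain ⟨s, u, huM, hu', hidem, hgen⟩ := h.exists_generator le_rfl h.smul_mem hw hw'
  obtain ⟨c, hc⟩ := hgen (f u) (hM u huM)
  have key : f u - c s • u ∈ M' := by
    have h1 := h.smul_mem' s s _ hc
    rw [smul_sub, Finset.smul_sum, ← hf] at h1
    have h2 : ∑ t, c t • (op (a s s) • op (a s t) • u -
        (if t = s then op (a s s) • u else 0)) ∈ M' :=
      sum_mem fun t _ => M'.smul_mem _ (h.smul_smul s t s s u huM)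
    simp only [smul_sub, Finset.sum_sub_distrib, smul_ite, smul_zero] at h2
    rw [Finset.sum_ite_eq' Finset.univ s] at h2
    simp only [smul_comm (op (a s s)) (c _)] at h1
    have h3 : f (op (a s s) • u) - c s • op (a s s) • u ∈ M' := by
      have := add_mem h1 h2
      simpa using this
    have h4 := hM' _ hidem
    rw [map_sub] at h4
    have h5 := M'.smul_mem (c s) hidem
    rw [smul_sub] at h5
    have := add_mem (sub_mem h3 h4) h5
    convert this using 1
    abel
  refine ⟨c s, fun v hv => ?_⟩
  have := h.map_mem (f := f - c s • 1) (L := M') (fun e w => ?_) h.smul_mem' (fun w hw => ?_) huM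
    hu' (by simpa using key) hv
  · simpa using this
  · simp [hf, smul_sub, smul_comm (c s)]
  · simpa using sub_mem (hM' w hw) (M'.smul_mem (c s) hw)

end IsMatrixLayer

end Layer

end DElliptic

end

open scoped TensorProduct

noncomputable section

namespace DElliptic

universe v

attribute [local instance] TensorProduct.Algebra.module

section IntegerTower

variable {k : Type*} [Semiring k] {V : ℤ → Type v} [∀ i, AddCommMonoid (V i)] [∀ i, Module k (V i)]

/-- The identifications of all terms of a sequence of isomorphisms with the term of index `0`. -/
def towerEquiv (e : ∀ i, V i ≃ₗ[k] V (i + 1)) : ∀ i, V 0 ≃ₗ[k] V i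
  | Int.ofNat n => Nat.rec (LinearEquiv.refl k (V 0)) (fun n f => f.trans (e (Int.ofNat n))) n
  | Int.negSucc n => Nat.rec (motive := fun n => V 0 ≃ₗ[k] V (Int.negSucc n))
      (e (Int.negSucc 0)).symm (fun n f => f.trans (e (Int.negSucc (n + 1))).symm) n

theorem towerEquiv_zero (e : ∀ i, V i ≃ₗ[k] V (i + 1)) (w : V 0) : towerEquiv e 0 w = w := rfl

theorem towerEquiv_succ (e : ∀ i, V i ≃ₗ[k] V (i + 1)) (i : ℤ) (w : V 0) :
    towerEquiv e (i + 1) w = e i (towerEquiv e i w) := by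
  rcases i with n | (_ | n)
  · rfl
  · exact ((e (Int.negSucc 0)).apply_symm_apply w).symm
  · exact ((e (Int.negSucc (n + 1))).apply_symm_apply (towerEquiv e (Int.negSucc n) w)).symm

end IntegerTower

variable {𝔽 F D : Type*} [Field 𝔽] [Field F] [Algebra 𝔽 F] [Ring D] [Algebra F D]
  {𝒟 : OrderSheaf 𝔽 F D} {k : Type*} [Field k] [Algebra 𝔽 k] {n : ℕ}

open MulOpposite

namespace Bundle

theorem smul_eq_op_smul (ℰ : Bundle.{v} 𝒟 k n) (f : F) (w : ℰ.V) :
    f • w = op (algebraMap F D f) • w := by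
  rw [← one_smul Dᵐᵒᵖ w, ← smul_assoc, one_smul, Algebra.algebraMap_eq_smul_one, op_smul, op_one]

theorem tmul_smul_eq (ℰ : Bundle.{v} 𝒟 k n) (f : F) (a : k) (w : ℰ.V) :
    (f ⊗ₜ[𝔽] a) • w = f • a • w :=
  TensorProduct.Algebra.smul_def f a w

theorem smul_smul_tensor (ℰ : Bundle.{v} 𝒟 k n) (f : F) (c : F ⊗[𝔽] k) (w : ℰ.V) :
    (f • c) • w = f • c • w := by
  induction c using TensorProduct.induction_on with
  | zero => simp
  | add c c' h h' => rw [smul_add, add_smul, add_smul, smul_add, h, h']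
  | tmul g a => rw [TensorProduct.smul_tmul', tmul_smul_eq, tmul_smul_eq, smul_eq_mul, mul_smul]

theorem smul_tmul_eq (ℰ : Bundle.{v} 𝒟 k n) (f : F) (w : ℰ.V) :
    (f ⊗ₜ[𝔽] (1 : k)) • w = f • w := by
  rw [tmul_smul_eq, one_smul]

theorem repr_smul (ℰ : Bundle.{v} 𝒟 k n) (b : Module.Basis (Fin n) (F ⊗[𝔽] k) ℰ.V) (f : F)
    (w : ℰ.V) (m : Fin n) : b.repr (f • w) m = f • b.repr w m := by
  rw [← smul_tmul_eq, map_smul, Finsupp.smul_apply, smul_eq_mul]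
  rw [Algebra.smul_def]
  rfl

/-- The stalk of a bundle at a single place is the lattice spanned by a basis. -/
theorem exists_basis (ℰ : Bundle.{v} 𝒟 k n) (x : Place 𝔽 F) :
    ∃ b : Module.Basis (Fin n) (F ⊗[𝔽] k) ℰ.V,
      ∀ w, w ∈ ℰ.stalk x ↔ ∀ m, b.repr w m ∈ x.baseChange k := by
  obtain ⟨b, U, hx, -, h⟩ := ℰ.locallyFree x
  exact ⟨b, h x hx⟩

variable {x : Place 𝔽 F} {ϖ : F}

theorem exists_pow_smul_mem (ℰ : Bundle.{v} 𝒟 k n) (hϖ : x.IsUniformizer ϖ)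
    (hF : IsCurveFunctionField 𝔽 F) (w : ℰ.V) : ∃ m : ℕ, ϖ ^ m • w ∈ ℰ.stalk x := by
  obtain ⟨b, hb⟩ := ℰ.exists_basis x
  choose N hN using fun l => hϖ.exists_pow_smul_mem_baseChange hF (b.repr w l)
  refine ⟨Finset.univ.sup N, (hb _).2 fun l => ?_⟩
  rw [repr_smul]
  exact hN l _ (Finset.le_sup (Finset.mem_univ l))

theorem eq_zero_of_forall_mem (ℰ : Bundle.{v} 𝒟 k n) (hϖ : x.IsUniformizer ϖ)
    (hF : IsCurveFunctionField 𝔽 F) {w : ℰ.V} (hw : ∀ m : ℕ, (ϖ⁻¹) ^ m • w ∈ ℰ.stalk x) :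
    w = 0 := by
  obtain ⟨b, hb⟩ := ℰ.exists_basis x
  refine b.ext_elem fun l => ?_
  rw [map_zero, Finsupp.zero_apply]
  refine hϖ.eq_zero_of_forall_baseChange hF fun m => ?_
  rw [← repr_smul]
  exact (hb _).1 (hw m) l

end Bundle

section Cast

variable (ℰ : ℤ → Bundle.{v} 𝒟 k n) {i i' : ℤ} (h : i = i')

theorem cast_smul (f : F) (w : (ℰ i).V) :
    LinearEquiv.cast (R := k) (M := fun i => (ℰ i).V) h (f • w) =
      f • LinearEquiv.cast (R := k) (M := fun i => (ℰ i).V) h w := by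
  subst h; rfl

theorem cast_apply (J : ∀ i, (ℰ 0).V ≃ₗ[k] (ℰ i).V) (w : (ℰ 0).V) :
    LinearEquiv.cast (R := k) (M := fun i => (ℰ i).V) h (J i w) = J i' w := by
  subst h; rfl

theorem iterMap_apply (j : ∀ i, (ℰ i).V →ₗ[k] (ℰ (i + 1)).V)
    (J : ∀ i, (ℰ 0).V ≃ₗ[k] (ℰ i).V) (hJ : ∀ i w, J (i + 1) w = j i (J i w)) (i : ℤ) (m : ℕ)
    (w : (ℰ 0).V) : iterMap ℰ j i m (J i w) = J (i + m) w := by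
  induction m with
  | zero => exact cast_apply ℰ _ J w
  | succ m ih =>
    rw [iterMap, LinearMap.comp_apply, LinearMap.comp_apply, ih, ← hJ]
    exact cast_apply ℰ _ J w

end Cast

variable [Fintype 𝔽] [IsAlgClosure 𝔽 k]

namespace EllipticSheaf

variable {d : ℕ} {p o : Place 𝔽 F} {z : o.Residue →ₐ[𝔽] k} (E : EllipticSheaf.{v} 𝒟 d p o z)

theorem j_smul_field (i : ℤ) (f : F) (w : (E.ℰ i).V) : E.j i (f • w) = f • E.j i w := by
  rw [Bundle.smul_eq_op_smul, E.j_smul, Bundle.smul_eq_op_smul]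

theorem t_smul_field (i : ℤ) (f : F) (w : (E.ℰ i).V) : E.t i (f • w) = f • E.t i w := by
  rw [Bundle.smul_eq_op_smul, E.t_smul, Bundle.smul_eq_op_smul]

variable {ϖ : F}

theorem t_surjective (hϖ : p.IsUniformizer ϖ) (hF : IsCurveFunctionField 𝔽 F) (hop : o ≠ p)
    (i : ℤ) : Function.Surjective (E.t i) := by
  intro w
  obtain ⟨m, hm⟩ := (E.ℰ (i + 1)).exists_pow_smul_mem hϖ hF w
  rw [← E.map_t_eq i p hop.symm] at hm
  obtain ⟨u, -, hu⟩ := hm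
  refine ⟨(ϖ ^ m)⁻¹ • u, ?_⟩
  rw [t_smul_field, hu, inv_smul_smul₀ (pow_ne_zero m hϖ.ne_zero)]

theorem j_surjective (hϖ : p.IsUniformizer ϖ) (hF : IsCurveFunctionField 𝔽 F) (hd : 0 < d)
    (i : ℤ) : Function.Surjective (E.j i) := by
  obtain ⟨m, hm⟩ : ∃ m, d * p.deg = m + 1 :=
    Nat.exists_eq_succ_of_ne_zero (Nat.mul_pos hd (p.deg_pos hF)).ne'
  have key (i : ℤ) : Function.Surjective (E.j (i + m)) := by
    intro w
    let L := LinearEquiv.cast (R := k) (M := fun i => (E.ℰ i).V)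
      (by push_cast; ring : i + (m : ℤ) + 1 = i + ((m + 1 : ℕ) : ℤ))
    obtain ⟨l, hl⟩ := (E.ℰ (i + ((m + 1 : ℕ) : ℤ))).exists_pow_smul_mem hϖ hF (L w)
    have hper := E.periodic i p
    rw [hm] at hper
    rw [hper] at hl
    obtain ⟨u, -, hu⟩ := hl
    have h2 : L (E.j (i + m) (iterMap E.ℰ E.j i m u)) = L (ϖ ^ l • w) := by
      rw [cast_smul]; exact hu
    have h3 := L.injective h2
    refine ⟨(ϖ ^ l)⁻¹ • iterMap E.ℰ E.j i m u, ?_⟩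
    rw [j_smul_field, h3, inv_smul_smul₀ (pow_ne_zero l hϖ.ne_zero)]
  have := key (i - m)
  exact sub_add_cancel i (m : ℤ) ▸ this

/-- Identifications of the generic fibres of all `ℰ_i` with the one of `ℰ_0`, compatible with the
maps `j_i`. -/
structure Trivialization where
  J : ∀ i, (E.ℰ 0).V ≃ₗ[k] (E.ℰ i).V
  zero : ∀ w, J 0 w = w
  succ : ∀ i w, J (i + 1) w = E.j i (J i w)
  smul : ∀ i (a : D) w, J i (op a • w) = op a • J i w

theorem nonempty_trivialization (hϖ : p.IsUniformizer ϖ) (hF : IsCurveFunctionField 𝔽 F)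
    (hd : 0 < d) : Nonempty E.Trivialization := by
  let e (i : ℤ) : (E.ℰ i).V ≃ₗ[k] (E.ℰ (i + 1)).V :=
    LinearEquiv.ofBijective (E.j i) ⟨E.j_injective i, E.j_surjective hϖ hF hd i⟩
  have hs (i w) : towerEquiv e (i + 1) w = E.j i (towerEquiv e i w) := towerEquiv_succ e i w
  refine ⟨towerEquiv e, towerEquiv_zero e, hs, fun i => ?_⟩
  induction i using Int.induction_on with
  | zero => exact fun a w => rfl
  | succ i ih => exact fun a w => by rw [hs, hs, ih, E.j_smul]
  | pred i ih =>
    intro a w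
    apply E.j_injective
    rw [E.j_smul, ← hs, ← hs, sub_add_cancel]
    exact ih a w

namespace Trivialization

variable {E} (T : E.Trivialization)

theorem smul_field (i : ℤ) (f : F) (w : (E.ℰ 0).V) : T.J i (f • w) = f • T.J i w := by
  rw [Bundle.smul_eq_op_smul, T.smul, Bundle.smul_eq_op_smul]

/-- The stalk of `ℰ_i` at `x`, inside the generic fibre of `ℰ_0`. -/
def lattice (i : ℤ) (x : Place 𝔽 F) : Submodule k (E.ℰ 0).V :=
  ((E.ℰ i).stalk x).comap (T.J i).toLinearMap

theorem mem_lattice {i : ℤ} {x : Place 𝔽 F} {w : (E.ℰ 0).V} :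
    w ∈ T.lattice i x ↔ T.J i w ∈ (E.ℰ i).stalk x := Iff.rfl

theorem lattice_le_succ (i : ℤ) (x : Place 𝔽 F) : T.lattice i x ≤ T.lattice (i + 1) x := by
  intro w hw
  rw [mem_lattice, T.succ]
  exact E.map_j_le i x ⟨_, hw, rfl⟩

theorem lattice_mono (x : Place 𝔽 F) : Monotone fun i => T.lattice i x :=
  monotone_int_of_le_succ fun i => T.lattice_le_succ i x

theorem op_smul_mem_lattice {i : ℤ} {x : Place 𝔽 F} {a : D} (ha : a ∈ 𝒟.stalk x) {w : (E.ℰ 0).V}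
    (hw : w ∈ T.lattice i x) : op a • w ∈ T.lattice i x := by
  rw [mem_lattice, T.smul]
  exact (E.ℰ i).smul_mem x a _ ha hw

/-- The Frobenius of the generic fibre of `ℰ_0`. -/
def frobenius : (E.ℰ 0).V →ₛₗ[frob 𝔽 k] (E.ℰ 0).V := (T.J (0 + 1)).symm.toLinearMap.comp (E.t 0)

theorem J_frobenius (i : ℤ) : ∀ w, T.J (i + 1) (T.frobenius w) = E.t i (T.J i w) := by
  induction i using Int.induction_on with
  | zero =>
    intro w
    rw [T.zero w]
    exact (T.J (0 + 1)).apply_symm_apply _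
  | succ i ih =>
    intro w
    rw [T.succ (i + 1), ih, E.comm, T.succ i w]
  | pred i ih =>
    intro w
    apply E.j_injective
    rw [E.comm, ← T.succ, ← T.succ, sub_add_cancel]
    exact ih w

theorem frobenius_op_smul (a : D) (w : (E.ℰ 0).V) :
    T.frobenius (op a • w) = op a • T.frobenius w := by
  apply (T.J (0 + 1)).injective
  rw [T.smul, J_frobenius, J_frobenius, T.smul, E.t_smul]

theorem frobenius_smul_field (f : F) (w : (E.ℰ 0).V) :
    T.frobenius (f • w) = f • T.frobenius w := by
  rw [Bundle.smul_eq_op_smul, frobenius_op_smul, Bundle.smul_eq_op_smul]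

theorem frobenius_injective : Function.Injective T.frobenius :=
  (T.J (0 + 1)).symm.injective.comp (E.t_injective 0)

theorem frobenius_surjective (hϖ : p.IsUniformizer ϖ) (hF : IsCurveFunctionField 𝔽 F)
    (hop : o ≠ p) : Function.Surjective T.frobenius :=
  (T.J (0 + 1)).symm.surjective.comp (E.t_surjective hϖ hF hop 0)

theorem frobenius_mem_lattice_iff (hop : o ≠ p) {i : ℤ} {w : (E.ℰ 0).V} :
    T.frobenius w ∈ T.lattice (i + 1) p ↔ w ∈ T.lattice i p := by
  rw [mem_lattice, mem_lattice, J_frobenius, ← E.map_t_eq i p hop.symm]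
  constructor
  · rintro ⟨u, hu, h⟩
    rwa [← E.t_injective i h]
  · exact fun h => ⟨_, h, rfl⟩

theorem lattice_add (i : ℤ) : T.lattice (i + (d * p.deg : ℕ)) p =
    Submodule.span k {u | ∃ g ∈ p.divisorStalk p, ∃ w ∈ T.lattice i p, u = g • w} := by
  ext w
  have h1 : w ∈ T.lattice (i + (d * p.deg : ℕ)) p ↔ T.J i w ∈ (E.ℰ i).twistStalk p p := by
    rw [mem_lattice, E.periodic i p]
    constructor
    · rintro ⟨u, hu, h⟩
      obtain ⟨u, rfl⟩ := (T.J i).surjective u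
      rw [iterMap_apply E.ℰ E.j T.J T.succ] at h
      rwa [← (T.J _).injective h]
    · exact fun h => ⟨_, h, iterMap_apply E.ℰ E.j T.J T.succ i _ w⟩
  have h2 : (E.ℰ i).twistStalk p p = (Submodule.span k
      {u | ∃ g ∈ p.divisorStalk p, ∃ w ∈ T.lattice i p, u = g • w}).map (T.J i).toLinearMap := by
    rw [Submodule.map_span, Bundle.twistStalk]
    congr 1
    ext u
    constructor
    · rintro ⟨g, hg, w, hw, rfl⟩
      obtain ⟨w, rfl⟩ := (T.J i).surjective w
      exact ⟨g • w, ⟨g, hg, w, hw, rfl⟩, T.smul_field i g w⟩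
    · rintro ⟨_, ⟨g, hg, w, hw, rfl⟩, rfl⟩
      exact ⟨g, hg, T.J i w, hw, T.smul_field i g w⟩
  rw [h1, h2]
  exact (Submodule.mem_map_equiv _).trans (by rw [LinearEquiv.symm_apply_apply])

theorem smul_mem_lattice (hϖ : p.IsUniformizer ϖ) {i : ℤ} {w : (E.ℰ 0).V}
    (hw : w ∈ T.lattice (i + (d * p.deg : ℕ)) p) : ϖ • w ∈ T.lattice i p := by
  rw [lattice_add] at hw
  induction hw using Submodule.span_induction with
  | zero => simp
  | add u v _ _ hu hv => rw [smul_add]; exact add_mem hu hv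
  | smul c u _ hu => rw [smul_comm]; exact Submodule.smul_mem _ c hu
  | mem u h =>
    obtain ⟨g, hg, w, hw, rfl⟩ := h
    rw [smul_smul, Bundle.smul_eq_op_smul]
    refine T.op_smul_mem_lattice (𝒟.algebraMap_mem p _ ?_) hw
    exact hg ⟨ϖ, hϖ.mem⟩ fun _ => (p.ring.valuation_lt_one_iff _).2 hϖ.valuation_lt_one

theorem inv_smul_mem_lattice (hϖ : p.IsUniformizer ϖ) {i : ℤ} {w : (E.ℰ 0).V}
    (hw : w ∈ T.lattice i p) : ϖ⁻¹ • w ∈ T.lattice (i + (d * p.deg : ℕ)) p := by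
  rw [lattice_add]
  refine Submodule.subset_span ⟨ϖ⁻¹, fun f hf => ?_, w, hw, rfl⟩
  rw [mul_comm]
  exact hϖ.inv_mul_mem ((p.ring.valuation_lt_one_iff f).1 (hf rfl))

theorem exists_mem_lattice (hϖ : p.IsUniformizer ϖ) (hF : IsCurveFunctionField 𝔽 F)
    (w : (E.ℰ 0).V) : ∃ i, w ∈ T.lattice i p := by
  obtain ⟨m, hm⟩ := (E.ℰ 0).exists_pow_smul_mem hϖ hF w
  have h0 : ϖ ^ m • w ∈ T.lattice 0 p := by rwa [mem_lattice, T.zero]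
  have key : ∀ m : ℕ, ∀ i, ∀ w : (E.ℰ 0).V, ϖ ^ m • w ∈ T.lattice i p → ∃ i, w ∈ T.lattice i p := by
    intro m
    induction m with
    | zero => exact fun i w h => ⟨i, by simpa using h⟩
    | succ m ih =>
      intro i w h
      refine ih (i + (d * p.deg : ℕ)) w ?_
      have := T.inv_smul_mem_lattice hϖ h
      rwa [pow_succ' ϖ, mul_smul, inv_smul_smul₀ hϖ.ne_zero] at this
  exact key m 0 w h0

theorem exists_notMem_lattice (hϖ : p.IsUniformizer ϖ) (hF : IsCurveFunctionField 𝔽 F)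
    {w : (E.ℰ 0).V} (hw : w ≠ 0) : ∃ i, w ∉ T.lattice i p := by
  by_contra! hall
  refine hw ((E.ℰ 0).eq_zero_of_forall_mem hϖ hF fun m => ?_)
  have key : ∀ m : ℕ, ∀ i, (ϖ⁻¹) ^ m • w ∈ T.lattice i p := by
    intro m
    induction m with
    | zero => intro i; simpa using hall i
    | succ m ih =>
      intro i
      rw [pow_succ' ϖ⁻¹, mul_smul, ← sub_add_cancel i ((d * p.deg : ℕ) : ℤ)]
      exact T.inv_smul_mem_lattice hϖ (ih _)
  have := key m 0
  rwa [mem_lattice, T.zero] at this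

theorem smul_mem_lattice_pred (hϖ : p.IsUniformizer ϖ) (hF : IsCurveFunctionField 𝔽 F)
    (hd : 0 < d) {i : ℤ} {w : (E.ℰ 0).V} (hw : w ∈ T.lattice i p) :
    ϖ • w ∈ T.lattice (i - 1) p := by
  have hpos : 0 < d * p.deg := Nat.mul_pos hd (p.deg_pos hF)
  rw [← sub_add_cancel i ((d * p.deg : ℕ) : ℤ)] at hw
  exact T.lattice_mono p (by omega) (T.smul_mem_lattice hϖ hw)

/-- Any `d + 1` sections of `ℰ_{i+1}` are linearly dependent modulo `ℰ_i`. -/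
theorem dependent_lattice (i : ℤ) (x : Place 𝔽 F) (v : Fin (d + 1) → (E.ℰ 0).V)
    (hv : ∀ l, v l ∈ T.lattice (i + 1) x) :
    ∃ c : Fin (d + 1) → k, c ≠ 0 ∧ ∑ l, c l • v l ∈ T.lattice i x := by
  classical
  let W (x : Place 𝔽 F) := (E.ℰ (i + 1)).stalk x ⧸
    (((E.ℰ i).stalk x).map (E.j i)).submoduleOf ((E.ℰ (i + 1)).stalk x)
  have hrank : Module.rank k (W x) ≤ d := by
    have h1 := LinearMap.lift_rank_le_of_injective (DirectSum.lof k (Place 𝔽 F) W x)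
      (DirectSum.of_injective x)
    rw [E.rank_coker_j i, Cardinal.lift_natCast, Cardinal.lift_le_nat_iff] at h1
    exact h1
  let u : Fin (d + 1) → W x := fun l => Submodule.Quotient.mk ⟨T.J (i + 1) (v l), hv l⟩
  have hdep : ¬ LinearIndependent k u := by
    intro h
    have h1 := h.cardinal_lift_le_rank.trans (Cardinal.lift_le.2 hrank)
    simp only [Cardinal.mk_fin, Cardinal.lift_natCast, Nat.cast_le] at h1
    omega
  rw [Fintype.not_linearIndependent_iff] at hdep
  obtain ⟨c, hc, l, hl⟩ := hdep
  refine ⟨c, fun h => hl (by rw [h]; rfl), ?_⟩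
  have h3 : (Submodule.Quotient.mk (∑ l, c l • (⟨T.J (i + 1) (v l), hv l⟩ :
      (E.ℰ (i + 1)).stalk x)) : W x) = 0 := by
    rw [← hc, ← Submodule.mkQ_apply, map_sum]
    rfl
  rw [Submodule.Quotient.mk_eq_zero] at h3
  obtain ⟨y, hy, h4⟩ := h3
  have h5 : E.j i y = E.j i (T.J i (∑ l, c l • v l)) := by
    rw [h4, ← T.succ]
    simp
  rw [mem_lattice, ← E.j_injective i h5]
  exact hy

end Trivialization

end EllipticSheaf

end DElliptic

end

open scoped TensorProduct

noncomputable section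

namespace DElliptic

open MulOpposite Polynomial

section Eigenspaces

variable {K N : Type*} [Field K] [AddCommGroup N] [Module K N]

theorem iSup_eigenspace_eq_top (f : Module.End K N) (S : Finset K)
    (hf : aeval f (∏ β ∈ S, (X - C β)) = 0) : ⨆ β : S, f.eigenspace β = ⊤ := by
  classical
  have key : ∀ S : Finset K, (aeval f (∏ β ∈ S, (X - C β))).ker ≤ ⨆ β ∈ S, f.eigenspace β := by
    intro S
    induction S using Finset.induction_on with
    | empty => intro w hw; simpa using hw
    | insert β S hβ ih =>
      have hcop : IsCoprime (X - C β) (∏ γ ∈ S, (X - C γ)) :=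
        IsCoprime.prod_right fun γ hγ =>
          pairwise_coprime_X_sub_C Function.injective_id fun h => hβ (h ▸ hγ)
      rw [Finset.prod_insert hβ, ← sup_ker_aeval_eq_ker_aeval_mul_of_coprime f hcop,
        Finset.iSup_insert]
      refine sup_le_sup (le_of_eq ?_) ih
      rw [Module.End.eigenspace_def]
      simp [Algebra.algebraMap_eq_smul_one]
  rw [← top_le_iff, iSup_subtype]
  refine le_trans ?_ (key S)
  rw [hf, LinearMap.ker_zero]

theorem finrank_eq_sum_eigenspace [Module.Finite K N] (f : Module.End K N) (S : Finset K)
    (hf : aeval f (∏ β ∈ S, (X - C β)) = 0) :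
    Module.finrank K N = ∑ β ∈ S, Module.finrank K (f.eigenspace β) := by
  classical
  have hind : iSupIndep fun β : S => f.eigenspace β :=
    f.eigenspaces_iSupIndep.comp Subtype.val_injective
  have hint := DirectSum.isInternal_submodule_of_iSupIndep_of_iSup_eq_top hind
    (iSup_eigenspace_eq_top f S hf)
  rw [← (LinearEquiv.ofBijective (DirectSum.coeLinearMap fun β : S => f.eigenspace (β : K))
    hint).finrank_eq, Module.finrank_directSum,
    ← Finset.sum_coe_sort S]

variable {F D : Type*} [Field F] [DivisionRing D] [Algebra F D] [Algebra.IsCentral F D]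
  [FiniteDimensional F D] [Algebra F K] [Module F N] [IsScalarTower F K N] [Module Dᵐᵒᵖ N]
  [IsScalarTower F Dᵐᵒᵖ N] [SMulCommClass K Dᵐᵒᵖ N]

/-- If `N` is the direct sum of eigenspaces of equal dimension of an endomorphism that is linear
over `D`, then their number divides the degree of `D`. -/
theorem card_dvd_of_finrank_eigenspace {d : ℕ} (hd : Module.finrank F D = d ^ 2)
    (hN : Module.finrank K N = d ^ 2) (f : Module.End K N)
    (hfD : ∀ (a : D) w, f (op a • w) = op a • f w) (S : Finset K)
    (hf : aeval f (∏ β ∈ S, (X - C β)) = 0)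
    (heq : ∀ β ∈ S, ∀ γ ∈ S,
      Module.finrank K (f.eigenspace β) = Module.finrank K (f.eigenspace γ)) :
    S.card ∣ d := by
  have hdpos : 0 < d ^ 2 := hd ▸ Module.finrank_pos
  have : Module.Finite K N := Module.finite_of_finrank_pos (hN ▸ hdpos)
  have hopd : Module.finrank F Dᵐᵒᵖ = d ^ 2 := by
    rw [← hd]; exact (MulOpposite.opLinearEquiv F).finrank_eq.symm
  have : FiniteDimensional F Dᵐᵒᵖ := Module.Finite.equiv (MulOpposite.opLinearEquiv F)
  obtain ⟨m, e, hmd, hme, hdvd⟩ := exists_dvd_finrank_of_central (K := K) hopd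
  have hsum := finrank_eq_sum_eigenspace f S hf
  rcases S.eq_empty_or_nonempty with rfl | ⟨β, hβ⟩
  · rw [Finset.sum_empty, hN] at hsum
    omega
  rw [Finset.sum_congr rfl fun γ hγ => heq γ hγ β hβ, Finset.sum_const, smul_eq_mul, hN,
    ← hme] at hsum
  have := SMulCommClass.symm K Dᵐᵒᵖ N
  let act (a : Dᵐᵒᵖ) : Module.End K N :=
    { toFun := fun w => a • w
      map_add' := smul_add a
      map_smul' := fun c w => smul_comm a c w }
  have hact (a : Dᵐᵒᵖ) : ∀ w ∈ f.eigenspace β, act a w ∈ f.eigenspace β := by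
    intro w hw
    rw [Module.End.mem_eigenspace_iff] at hw ⊢
    change f (a • w) = β • a • w
    rw [← op_unop a, hfD, hw, smul_comm]
  let g : Dᵐᵒᵖ →ₐ[F] Module.End K (f.eigenspace β) := AlgHom.ofLinearMap
    { toFun := fun a => (act a).restrict (hact a)
      map_add' := fun a b => by ext w; exact add_smul a b (w : N)
      map_smul' := fun c a => by ext w; exact smul_assoc c a (w : N) }
    (by ext w; exact one_smul _ (w : N)) (fun a b => by ext w; exact mul_smul a b (w : N))
  obtain ⟨l, hl⟩ := hdvd _ g
  rw [hl] at hsum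
  have hme0 : 0 < m * e := by
    rcases Nat.eq_zero_or_pos (m * e) with h | h
    · rw [sq, mul_assoc, h, mul_zero] at hme
      omega
    · exact h
  have : m = S.card * l := Nat.eq_of_mul_eq_mul_right hme0 (by linarith)
  exact (Dvd.intro l this.symm).trans hmd

end Eigenspaces

section FiniteFields

variable {𝔽 k : Type*} [Field 𝔽] [Fintype 𝔽] [Field k] [Algebra 𝔽 k] [Algebra.IsAlgebraic 𝔽 k]

/-- The conjugates of an element over a finite field are its images under powers of Frobenius. -/
theorem exists_eq_pow_of_aeval_minpoly {c β : k} (hβ : aeval β (minpoly 𝔽 c) = 0) :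
    ∃ n : ℕ, β = c ^ Fintype.card 𝔽 ^ n := by
  let L := IntermediateField.adjoin 𝔽 {c, β}
  have : FiniteDimensional 𝔽 L :=
    IntermediateField.finiteDimensional_adjoin fun a _ => Algebra.IsIntegral.isIntegral a
  have : Finite L := Module.finite_of_finite 𝔽
  let c' : L := ⟨c, IntermediateField.subset_adjoin _ _ (by simp)⟩
  let β' : L := ⟨β, IntermediateField.subset_adjoin _ _ (by simp)⟩
  have hc' : minpoly 𝔽 c' = minpoly 𝔽 c :=
    (minpoly.algebraMap_eq (algebraMap L k).injective c').symm
  have hroot : aeval β' (minpoly 𝔽 c') = 0 := by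
    apply (algebraMap L k).injective
    rw [hc', ← aeval_algebraMap_apply, map_zero]
    exact hβ
  obtain ⟨σ, hσ⟩ := minpoly.exists_algEquiv_of_root'
    (Algebra.IsAlgebraic.isAlgebraic c') hroot
  obtain ⟨n, hn⟩ := (FiniteField.bijective_frobeniusAlgEquivOfAlgebraic_pow 𝔽 L).2 σ
  refine ⟨n, ?_⟩
  have h2 : σ c' = c' ^ Fintype.card 𝔽 ^ (n : ℕ) := by
    rw [← hn, AlgEquiv.coe_pow, FiniteField.coe_frobeniusAlgEquivOfAlgebraic_iterate]
  rw [hσ] at h2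
  exact congrArg (algebraMap L k) h2

/-- If the degrees of all elements divide `d`, then so does the degree of the field. -/
theorem finrank_dvd_of_natDegree_dvd {d : ℕ} (hd : 0 < d) (L : IntermediateField 𝔽 k)
    (hL : ∀ c ∈ L, (minpoly 𝔽 c).natDegree ∣ d) : Module.finrank 𝔽 L ∣ d := by
  obtain ⟨⟨c, hc⟩, hmax⟩ : ∃ c : L, ∀ e : L,
      (minpoly 𝔽 (e : k)).natDegree ≤ (minpoly 𝔽 (c : k)).natDegree := by
    have hfin : (Set.range fun e : L => (minpoly 𝔽 (e : k)).natDegree).Finite :=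
      (Set.finite_Iic d).subset (by rintro _ ⟨e, rfl⟩; exact Nat.le_of_dvd hd (hL e e.2))
    obtain ⟨_, ⟨c, rfl⟩, h⟩ := hfin.exists_maximal (Set.range_nonempty _)
    refine ⟨c, fun e => ?_⟩
    rcases le_total (minpoly 𝔽 (e : k)).natDegree (minpoly 𝔽 (c : k)).natDegree with h' | h'
    · exact h'
    · exact h ⟨e, rfl⟩ h'
  have hint (e : k) : IsIntegral 𝔽 e := Algebra.IsIntegral.isIntegral e
  have hle : L ≤ IntermediateField.adjoin 𝔽 {c} := by
    intro e he
    let L' := IntermediateField.adjoin 𝔽 {c, e}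
    have : FiniteDimensional 𝔽 L' := IntermediateField.finiteDimensional_adjoin fun a _ => hint a
    have hL' : L' ≤ L := by
      rw [IntermediateField.adjoin_le_iff]
      rintro _ (rfl | rfl)
      exacts [hc, he]
    obtain ⟨γ, hγ⟩ := Field.exists_primitive_element 𝔽 L'
    have hdeg : Module.finrank 𝔽 L' = (minpoly 𝔽 (γ : k)).natDegree := by
      rw [← (Field.primitive_element_iff_minpoly_natDegree_eq 𝔽 γ).1 hγ]
      exact congrArg natDegree (minpoly.algebraMap_eq (algebraMap L' k).injective γ).symm
    have hcL' : IntermediateField.adjoin 𝔽 {c} ≤ L' :=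
      IntermediateField.adjoin.mono _ _ _ (by simp)
    have heq : IntermediateField.adjoin 𝔽 {c} = L' := by
      refine IntermediateField.eq_of_le_of_finrank_le hcL' ?_
      rw [hdeg, IntermediateField.adjoin.finrank (hint c)]
      exact hmax ⟨γ, hL' γ.2⟩
    rw [heq]
    exact IntermediateField.subset_adjoin _ _ (by simp)
  have : L = IntermediateField.adjoin 𝔽 {c} := le_antisymm hle (by
    rw [IntermediateField.adjoin_le_iff]; rintro _ rfl; exact hc)
  rw [this, IntermediateField.adjoin.finrank (hint c)]
  exact hL c hc

end FiniteFields

end DElliptic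

end

open scoped TensorProduct

noncomputable section

namespace DElliptic

universe v

attribute [local instance] TensorProduct.Algebra.module

open MulOpposite

variable {𝔽 F D : Type*} [Field 𝔽] [Field F] [Algebra 𝔽 F] [Ring D] [Algebra F D]
  {𝒟 : OrderSheaf 𝔽 F D} {k : Type*} [Field k] [Algebra 𝔽 k]

theorem map_tensor_smul {n n' : ℕ} {ℰ : Bundle.{v} 𝒟 k n} {ℰ' : Bundle.{v} 𝒟 k n'}
    {f : ℰ.V →ₗ[k] ℰ'.V} (hf : ∀ (a : D) w, f (op a • w) = op a • f w) (c : F ⊗[𝔽] k) (w : ℰ.V) :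
    f (c • w) = c • f w := by
  induction c using TensorProduct.induction_on with
  | zero => simp
  | add c c' h h' => rw [add_smul, map_add, h, h', add_smul]
  | tmul g a => rw [Bundle.tmul_smul_eq, Bundle.smul_eq_op_smul, hf, map_smul,
      ← Bundle.smul_eq_op_smul, ← Bundle.tmul_smul_eq]

/-- A `k`-linear and `D`-linear endomorphism of a generic fibre is linear over `F ⊗ k`. -/
def tensorLinear {n : ℕ} {ℰ : Bundle.{v} 𝒟 k n} (f : Module.End k ℰ.V)
    (hf : ∀ (a : D) w, f (op a • w) = op a • f w) : Module.End (F ⊗[𝔽] k) ℰ.V where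
  toFun := f
  map_add' := map_add f
  map_smul' := map_tensor_smul hf

variable [Fintype 𝔽] [IsAlgClosure 𝔽 k]

namespace EllipticSheaf

variable {d : ℕ} {p o : Place 𝔽 F} {z : o.Residue →ₐ[𝔽] k} {E : EllipticSheaf.{v} 𝒟 d p o z}

namespace Trivialization

variable (T : E.Trivialization) {ϖ : F}

/-- The endomorphisms of the generic fibre that commute with `D` and with the Frobenius. -/
structure Commutes (f : Module.End k (E.ℰ 0).V) : Prop where
  op_smul : ∀ (a : D) w, f (op a • w) = op a • f w
  frobenius : ∀ w, f (T.frobenius w) = T.frobenius (f w)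

theorem exists_basis_lattice (i : ℤ) (x : Place 𝔽 F) :
    ∃ b : Module.Basis (Fin (d ^ 2)) (F ⊗[𝔽] k) (E.ℰ 0).V,
      ∀ w, w ∈ T.lattice i x ↔ ∀ m, b.repr w m ∈ x.baseChange k := by
  obtain ⟨b, hb⟩ := (E.ℰ i).exists_basis x
  let e : (E.ℰ 0).V ≃ₗ[F ⊗[𝔽] k] (E.ℰ i).V :=
    { T.J i with
      map_smul' := fun c w => map_tensor_smul (f := (T.J i).toLinearMap) (T.smul i) c w }
  exact ⟨b.map e.symm, fun w => hb (T.J i w)⟩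

theorem baseChange_smul_mem {i : ℤ} {x : Place 𝔽 F} {c : F ⊗[𝔽] k} (hc : c ∈ x.baseChange k)
    {w : (E.ℰ 0).V} (hw : w ∈ T.lattice i x) : c • w ∈ T.lattice i x := by
  obtain ⟨b, hb⟩ := T.exists_basis_lattice i x
  rw [hb] at hw ⊢
  intro m
  rw [map_smul, Finsupp.smul_apply, smul_eq_mul]
  exact mul_mem hc (hw m)

theorem isMatrixLayer_lattice (hϖ : p.IsUniformizer ϖ) (hF : IsCurveFunctionField 𝔽 F)
    (hd : 0 < d) {a : Fin d → Fin d → D} (ha : ∀ s t, a s t ∈ 𝒟.stalk p)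
    (hmul : ∀ s t s' t', ∃ e ∈ 𝒟.stalk p,
      a s t * a s' t' - (if t = s' then a s t' else 0) = ϖ • e)
    (hone : ∃ e ∈ 𝒟.stalk p, 1 - ∑ s, a s s = ϖ • e) (i : ℤ) :
    IsMatrixLayer a (T.lattice (i - 1) p) (T.lattice i p) := by
  have hϖe (e : D) (he : e ∈ 𝒟.stalk p) (w : (E.ℰ 0).V) (hw : w ∈ T.lattice i p) :
      op (ϖ • e) • w ∈ T.lattice (i - 1) p := by
    rw [MulOpposite.op_smul, smul_assoc]
    exact T.smul_mem_lattice_pred hϖ hF hd (T.op_smul_mem_lattice he hw)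
  refine ⟨T.lattice_mono p (by omega), fun s t w hw => T.op_smul_mem_lattice (ha s t) hw,
    fun s t w hw => T.op_smul_mem_lattice (ha s t) hw, fun s t s' t' w hw => ?_,
    fun w hw => ?_, fun v hv => T.dependent_lattice (i - 1) p v (by simpa using hv)⟩
  · obtain ⟨e, he, h⟩ := hmul s t s' t'
    have := hϖe e he w hw
    rw [← h, op_sub, op_mul, sub_smul, mul_smul] at this
    split_ifs at this ⊢ <;> simpa using this
  · obtain ⟨e, he, h⟩ := hone
    have := hϖe e he w hw
    rw [← h, op_sub, op_one, sub_smul, one_smul, Finset.op_sum, Finset.sum_smul] at this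
    exact this

theorem exists_level (hϖ : p.IsUniformizer ϖ) (hF : IsCurveFunctionField 𝔽 F) {w : (E.ℰ 0).V}
    (hw : w ≠ 0) : ∃ i, w ∈ T.lattice i p ∧ w ∉ T.lattice (i - 1) p := by
  obtain ⟨b, hb⟩ := T.exists_notMem_lattice hϖ hF hw
  obtain ⟨i, hi, hmin⟩ := Int.exists_least_of_bdd (P := fun i => w ∈ T.lattice i p)
    ⟨b, fun i hi => by
      by_contra hlt
      exact hb (T.lattice_mono p (not_le.1 hlt).le hi)⟩ (T.exists_mem_lattice hϖ hF w)
  exact ⟨i, hi, fun h => by have := hmin _ h; omega⟩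

variable {T} {f : Module.End k (E.ℰ 0).V}

namespace Commutes

theorem mapsTo_shift (hf : T.Commutes f) (hϖ : p.IsUniformizer ϖ)
    (hF : IsCurveFunctionField 𝔽 F) (hop : o ≠ p) (i m : ℤ) :
    (∀ w ∈ T.lattice (i + 1) p, f w ∈ T.lattice (i + 1 + m) p) ↔
      ∀ w ∈ T.lattice i p, f w ∈ T.lattice (i + m) p := by
  constructor
  · intro h w hw
    have := h _ ((T.frobenius_mem_lattice_iff hop).2 hw)
    rwa [hf.frobenius, add_right_comm, T.frobenius_mem_lattice_iff hop] at this
  · intro h w hw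
    obtain ⟨u, rfl⟩ := T.frobenius_surjective hϖ hF hop w
    rw [T.frobenius_mem_lattice_iff hop] at hw
    rw [hf.frobenius, add_right_comm, T.frobenius_mem_lattice_iff hop]
    exact h u hw

theorem mapsTo_iff_zero (hf : T.Commutes f) (hϖ : p.IsUniformizer ϖ)
    (hF : IsCurveFunctionField 𝔽 F) (hop : o ≠ p) (m i : ℤ) :
    (∀ w ∈ T.lattice i p, f w ∈ T.lattice (i + m) p) ↔
      ∀ w ∈ T.lattice 0 p, f w ∈ T.lattice (0 + m) p := by
  induction i using Int.induction_on with
  | zero => rfl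
  | succ i ih => rw [hf.mapsTo_shift hϖ hF hop, ih]
  | pred i ih => rw [← hf.mapsTo_shift hϖ hF hop, sub_add_cancel, ih]

theorem exists_mapsTo (hf : T.Commutes f) (hϖ : p.IsUniformizer ϖ)
    (hF : IsCurveFunctionField 𝔽 F) : ∃ m, ∀ w ∈ T.lattice 0 p, f w ∈ T.lattice m p := by
  obtain ⟨b, hb⟩ := T.exists_basis_lattice 0 p
  choose m hm using fun l => T.exists_mem_lattice hϖ hF (f (b l))
  obtain ⟨M, hM⟩ := (Set.finite_range m).bddAbove
  refine ⟨M, fun w hw => ?_⟩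
  rw [← b.sum_repr w, map_sum]
  refine sum_mem fun l _ => ?_
  rw [map_tensor_smul hf.op_smul]
  exact T.baseChange_smul_mem ((hb w).1 hw l) (T.lattice_mono p (hM ⟨l, rfl⟩) (hm l))

/-- A non-zero endomorphism of the generic fibre shifts the filtration at the pole by a constant,
and is injective on the graded pieces. -/
theorem exists_shift (hf : T.Commutes f) (hϖ : p.IsUniformizer ϖ)
    (hF : IsCurveFunctionField 𝔽 F) (hop : o ≠ p) {a : Fin d → Fin d → D}
    (ha : ∀ i, IsMatrixLayer a (T.lattice (i - 1) p) (T.lattice i p)) (h0 : f ≠ 0) :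
    ∃ m : ℤ, (∀ i, ∀ w ∈ T.lattice i p, f w ∈ T.lattice (i + m) p) ∧
      ∀ i, ∀ w ∈ T.lattice i p, w ∉ T.lattice (i - 1) p → f w ∉ T.lattice (i + m - 1) p := by
  obtain ⟨w₀, hw₀⟩ : ∃ w, f w ≠ 0 := by
    by_contra! h
    exact h0 (LinearMap.ext h)
  obtain ⟨i₀, hi₀⟩ := T.exists_mem_lattice hϖ hF w₀
  obtain ⟨j₀, hj₀⟩ := T.exists_notMem_lattice hϖ hF hw₀
  obtain ⟨m, hm, hmin⟩ := Int.exists_least_of_bdd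
    (P := fun m => ∀ w ∈ T.lattice 0 p, f w ∈ T.lattice (0 + m) p)
    ⟨j₀ - i₀, fun m hm => by
      by_contra hlt
      exact hj₀ (T.lattice_mono p (by omega)
        ((hf.mapsTo_iff_zero hϖ hF hop m i₀).2 hm w₀ hi₀))⟩
    (by
      obtain ⟨m, hm⟩ := hf.exists_mapsTo hϖ hF
      exact ⟨m, by simpa using hm⟩)
  have hall (i) := (hf.mapsTo_iff_zero hϖ hF hop m i).2 hm
  refine ⟨m, hall, fun i w hw hw' hfw => ?_⟩
  have h1 : ∀ v ∈ T.lattice i p, f v ∈ T.lattice (i + (m - 1)) p := fun v hv => by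
    rw [← add_sub_assoc]
    refine (ha i).map_mem hf.op_smul (ha (i + m)).smul_mem' (fun u hu => ?_) hw hw' hfw hv
    have := hall _ u hu
    rwa [sub_add_eq_add_sub] at this
  have := hmin _ ((hf.mapsTo_iff_zero hϖ hF hop (m - 1) i).1 h1)
  omega

theorem injective (hf : T.Commutes f) (hϖ : p.IsUniformizer ϖ)
    (hF : IsCurveFunctionField 𝔽 F) (hop : o ≠ p) {a : Fin d → Fin d → D}
    (ha : ∀ i, IsMatrixLayer a (T.lattice (i - 1) p) (T.lattice i p)) (h0 : f ≠ 0) :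
    Function.Injective f := by
  obtain ⟨m, -, hm⟩ := hf.exists_shift hϖ hF hop ha h0
  rw [injective_iff_map_eq_zero]
  intro w hw
  by_contra hne
  obtain ⟨i, hi, hi'⟩ := T.exists_level hϖ hF hne
  refine hm i w hi hi' ?_
  rw [hw]
  exact zero_mem _

/-- An endomorphism over `X` whose inverse on the generic fibre exists is an automorphism. -/
theorem exists_inverse (hf : T.Commutes f) (hF : IsCurveFunctionField 𝔽 F)
    (hfin : ∀ i x, ∀ w ∈ T.lattice i x, f w ∈ T.lattice i x) (hinj : Function.Injective f) :
    ∃ g, T.Commutes g ∧ (∀ i x, ∀ w ∈ T.lattice i x, g w ∈ T.lattice i x) ∧ f * g = 1 ∧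
      g * f = 1 := by
  have : Algebra.IsAlgebraic 𝔽 k := IsAlgClosure.isAlgebraic
  have hK : IsField (F ⊗[𝔽] k) := hF.isField_tensorProduct
  have : IsArtinianRing (F ⊗[𝔽] k) := by
    let := hK.toField
    infer_instance
  obtain ⟨b₀, -⟩ := T.exists_basis_lattice 0 p
  have : Module.Finite (F ⊗[𝔽] k) (E.ℰ 0).V := Module.Finite.of_basis b₀
  let fK := tensorLinear f hf.op_smul
  have hsurj : Function.Surjective fK := IsArtinian.surjective_of_injective_endomorphism fK hinj
  let e := LinearEquiv.ofBijective fK ⟨hinj, hsurj⟩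
  let g : Module.End k (E.ℰ 0).V := (LinearEquiv.ofBijective f ⟨hinj, hsurj⟩).symm.toLinearMap
  have hfg (w) : f (g w) = w := (LinearEquiv.ofBijective f ⟨hinj, hsurj⟩).apply_symm_apply w
  have hgf (w) : g (f w) = w := (LinearEquiv.ofBijective f ⟨hinj, hsurj⟩).symm_apply_apply w
  have hgD (a : D) (w) : g (op a • w) = op a • g w := hinj (by rw [hf.op_smul, hfg, hfg])
  have hentry {i : ℤ} {x : Place 𝔽 F} {b : Module.Basis (Fin (d ^ 2)) (F ⊗[𝔽] k) (E.ℰ 0).V}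
      (hb : ∀ w, w ∈ T.lattice i x ↔ ∀ m, b.repr w m ∈ x.baseChange k) (r c : Fin (d ^ 2)) :
      LinearMap.toMatrix b b fK r c ∈ x.baseChange k := by
    rw [LinearMap.toMatrix_apply]
    refine (hb _).1 (hfin i x _ ((hb _).2 fun m => ?_)) r
    rw [b.repr_self, Finsupp.single_apply]
    split_ifs
    exacts [one_mem _, zero_mem _]
  have hlift {i : ℤ} {x : Place 𝔽 F} {b : Module.Basis (Fin (d ^ 2)) (F ⊗[𝔽] k) (E.ℰ 0).V}
      (hb : ∀ w, w ∈ T.lattice i x ↔ ∀ m, b.repr w m ∈ x.baseChange k) :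
      ∃ A : Matrix (Fin (d ^ 2)) (Fin (d ^ 2)) (x.baseChange k),
        (x.baseChange k).val.toRingHom.mapMatrix A = LinearMap.toMatrix b b fK :=
    ⟨.of fun r c => ⟨_, hentry hb r c⟩, rfl⟩
  have hdetmem (x : Place 𝔽 F) : LinearMap.det fK ∈ x.baseChange k := by
    obtain ⟨b, hb⟩ := T.exists_basis_lattice 0 x
    obtain ⟨A, hA⟩ := hlift hb
    rw [← LinearMap.det_toMatrix b, ← hA, ← RingHom.map_det]
    exact A.det.2
  obtain ⟨c, hc⟩ := Place.exists_tmul_eq_of_forall_mem hF hdetmem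
  have hc0 : c ≠ 0 := by
    rintro rfl
    have hu : IsUnit (LinearMap.det fK) := e.isUnit_det'
    rw [← hc, TensorProduct.tmul_zero] at hu
    have : Nontrivial (F ⊗[𝔽] k) := hK.nontrivial
    exact not_isUnit_zero hu
  have hgfin : ∀ i x, ∀ w ∈ T.lattice i x, g w ∈ T.lattice i x := by
    intro i x w hw
    obtain ⟨b, hb⟩ := T.exists_basis_lattice i x
    obtain ⟨A, hA⟩ := hlift hb
    let gK := tensorLinear g hgD
    have hG : LinearMap.toMatrix b b gK * LinearMap.toMatrix b b fK = 1 := by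
      rw [← LinearMap.toMatrix_mul, ← LinearMap.toMatrix_one b]
      congr 1
      exact LinearMap.ext hgf
    have hadj : LinearMap.toMatrix b b gK = ((1 : F) ⊗ₜ[𝔽] c⁻¹) •
        (x.baseChange k).val.toRingHom.mapMatrix A.adjugate := by
      have h1 : LinearMap.toMatrix b b fK * (((1 : F) ⊗ₜ[𝔽] c⁻¹) •
          (x.baseChange k).val.toRingHom.mapMatrix A.adjugate) = 1 := by
        rw [Matrix.mul_smul, RingHom.map_adjugate, hA, Matrix.mul_adjugate, LinearMap.det_toMatrix,
          ← hc, smul_smul, Algebra.TensorProduct.tmul_mul_tmul, inv_mul_cancel₀ hc0, one_mul,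
          ← Algebra.TensorProduct.one_def, one_smul]
      calc _ = LinearMap.toMatrix b b gK * (LinearMap.toMatrix b b fK * _) := by
            rw [h1, mul_one]
        _ = _ := by rw [← mul_assoc, hG, one_mul]
    rw [hb]
    intro m
    have hrepr : b.repr (g w) m = ∑ l, LinearMap.toMatrix b b gK m l * b.repr w l := by
      have := congrFun (LinearMap.toMatrix_mulVec_repr b b gK w) m
      rw [Matrix.mulVec_eq_sum] at this
      rw [show g w = gK w from rfl, ← this]
      simp [mul_comm]
    rw [hrepr]
    refine sum_mem fun l _ => mul_mem ?_ ((hb w).1 hw l)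
    rw [hadj, Matrix.smul_apply, smul_eq_mul]
    refine mul_mem ⟨1 ⊗ₜ c⁻¹, by simp⟩ ?_
    exact (A.adjugate m l).2
  exact ⟨g, ⟨hgD, fun w => hinj (by rw [hf.frobenius, hfg, hfg])⟩, hgfin,
    LinearMap.ext hfg, LinearMap.ext hgf⟩

end Commutes

end Trivialization

end EllipticSheaf

end DElliptic

end

open scoped TensorProduct

noncomputable section

namespace DElliptic

universe v

attribute [local instance] TensorProduct.Algebra.module

open MulOpposite

theorem frob_apply {𝔽 k : Type*} [Field 𝔽] [Field k] [Algebra 𝔽 k] [Fintype 𝔽]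
    [IsAlgClosure 𝔽 k] (a : k) : frob 𝔽 k a = a ^ Fintype.card 𝔽 := rfl

theorem frob_algebraMap {𝔽 k : Type*} [Field 𝔽] [Field k] [Algebra 𝔽 k] [Fintype 𝔽]
    [IsAlgClosure 𝔽 k] (a : 𝔽) : frob 𝔽 k (algebraMap 𝔽 k a) = algebraMap 𝔽 k a := by
  rw [frob_apply, ← map_pow, FiniteField.pow_card]

section Ring

variable {𝔽 F D : Type*} [Field 𝔽] [Field F] [Algebra 𝔽 F] [Ring D] [Algebra F D]
  {𝒟 : OrderSheaf 𝔽 F D} {k : Type*} [Field k] [Algebra 𝔽 k] [Fintype 𝔽] [IsAlgClosure 𝔽 k]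
  {d : ℕ} {p o : Place 𝔽 F} {z : o.Residue →ₐ[𝔽] k} {E : EllipticSheaf.{v} 𝒟 d p o z}

namespace EllipticSheaf

theorem nontrivial_fibre (E : EllipticSheaf.{v} 𝒟 d p o z) (hF : IsCurveFunctionField 𝔽 F)
    (hd : 0 < d) : Nontrivial (E.ℰ 0).V := by
  have : Algebra.IsAlgebraic 𝔽 k := IsAlgClosure.isAlgebraic
  have : Nontrivial (F ⊗[𝔽] k) := hF.isField_tensorProduct.nontrivial
  obtain ⟨b, -⟩ := (E.ℰ 0).exists_basis p
  exact ⟨b ⟨0, pow_pos hd 2⟩, 0, b.ne_zero _⟩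

namespace Trivialization

variable (T : E.Trivialization) {ϖ : F} {U : Set (Place 𝔽 F)}

/-- The endomorphisms of the elliptic sheaf over `U`, as endomorphisms of the generic fibre. -/
def endAlgebra (U : Set (Place 𝔽 F)) : Subalgebra 𝔽 (Module.End k (E.ℰ 0).V) where
  carrier := {f | T.Commutes f ∧ ∀ i, ∀ x ∈ U, ∀ w ∈ T.lattice i x, f w ∈ T.lattice i x}
  mul_mem' := by
    rintro f g ⟨hf, hf'⟩ ⟨hg, hg'⟩
    refine ⟨⟨fun a w => ?_, fun w => ?_⟩, fun i x hx w hw => hf' i x hx _ (hg' i x hx w hw)⟩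
    · simp [hf.op_smul, hg.op_smul]
    · simp [hf.frobenius, hg.frobenius]
  add_mem' := by
    rintro f g ⟨hf, hf'⟩ ⟨hg, hg'⟩
    refine ⟨⟨fun a w => ?_, fun w => ?_⟩,
      fun i x hx w hw => add_mem (hf' i x hx w hw) (hg' i x hx w hw)⟩
    · simp [hf.op_smul, hg.op_smul]
    · simp [hf.frobenius, hg.frobenius]
  algebraMap_mem' a := by
    refine ⟨⟨fun c w => ?_, fun w => ?_⟩, fun i x _ w hw => ?_⟩
    · rw [Module.algebraMap_end_apply, Module.algebraMap_end_apply, ← algebraMap_smul k a (op c • w),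
        ← algebraMap_smul k a w, smul_comm]
    · rw [Module.algebraMap_end_apply, Module.algebraMap_end_apply, ← algebraMap_smul k,
        ← algebraMap_smul k a w, map_smulₛₗ, frob_algebraMap]
    · rw [Module.algebraMap_end_apply, ← algebraMap_smul k]
      exact Submodule.smul_mem _ _ hw

theorem endSections_apply {ψ : ∀ i, Module.End k (E.ℰ i).V} (hψ : ψ ∈ E.endSections U) (i : ℤ) :
    ∀ w, ψ i (T.J i w) = T.J i (ψ 0 w) := by
  induction i using Int.induction_on with
  | zero => intro w; rw [T.zero, T.zero]
  | succ i ih => intro w; rw [T.succ, hψ.2.1, ih, T.succ]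
  | pred i ih =>
    intro w
    apply E.j_injective
    rw [← hψ.2.1, ← T.succ, ← T.succ, sub_add_cancel]
    exact ih w

theorem apply_zero_mem_endAlgebra {ψ : ∀ i, Module.End k (E.ℰ i).V}
    (hψ : ψ ∈ E.endSections U) : ψ 0 ∈ T.endAlgebra U := by
  refine ⟨⟨hψ.1 0, fun w => ?_⟩, fun i x hx w hw => ?_⟩
  · apply (T.J (0 + 1)).injective
    rw [← T.endSections_apply hψ, T.J_frobenius, T.J_frobenius, hψ.2.2.1,
      T.endSections_apply hψ]
  · rw [T.mem_lattice, ← T.endSections_apply hψ]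
    exact hψ.2.2.2 i x hx _ hw

theorem conj_mem_endSections {f : Module.End k (E.ℰ 0).V} (hf : f ∈ T.endAlgebra U) :
    (fun i => (T.J i).conj f) ∈ E.endSections U := by
  have key (i : ℤ) (w : (E.ℰ 0).V) : (T.J i).conj f (T.J i w) = T.J i (f w) := by
    rw [LinearEquiv.conj_apply_apply, LinearEquiv.symm_apply_apply]
  refine ⟨fun i a w => ?_, fun i w => ?_, fun i w => ?_, fun i x hx w hw => ?_⟩ <;>
    obtain ⟨w, rfl⟩ := (T.J i).surjective w <;> dsimp only
  · rw [← T.smul, key, key, hf.1.op_smul, T.smul]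
  · rw [← T.succ, key, key, T.succ]
  · rw [← T.J_frobenius, key, key, hf.1.frobenius, T.J_frobenius]
  · rw [key]
    exact hf.2 i x hx w hw

/-- The ring of sections over `U` of the sheaf of endomorphisms acts faithfully on the generic
fibre. -/
def endSectionsEquiv (U : Set (Place 𝔽 F)) : E.endSections U ≃+* T.endAlgebra U where
  toFun ψ := ⟨ψ.1 0, T.apply_zero_mem_endAlgebra ψ.2⟩
  invFun f := ⟨_, T.conj_mem_endSections f.2⟩
  left_inv ψ := by
    refine Subtype.ext (funext fun i => LinearMap.ext fun w => ?_)
    obtain ⟨w, rfl⟩ := (T.J i).surjective w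
    rw [T.endSections_apply ψ.2]
    simp
  right_inv f := by
    refine Subtype.ext (LinearMap.ext fun w => ?_)
    have h : (T.J 0).conj f.1 (T.J 0 w) = T.J 0 (f.1 w) := by simp
    rwa [T.zero, T.zero] at h
  map_mul' _ _ := rfl
  map_add' _ _ := rfl

theorem mem_endSections_of_apply_zero {ψ : ∀ i, Module.End k (E.ℰ i).V}
    (hψ : ψ ∈ E.endSections U) {U' : Set (Place 𝔽 F)} (h : ψ 0 ∈ T.endAlgebra U') :
    ψ ∈ E.endSections U' := by
  refine ⟨hψ.1, hψ.2.1, hψ.2.2.1, fun i x hx w hw => ?_⟩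
  obtain ⟨w, rfl⟩ := (T.J i).surjective w
  rw [T.endSections_apply hψ]
  exact h.2 i x hx w hw

variable (hϖ : p.IsUniformizer ϖ) (hF : IsCurveFunctionField 𝔽 F) (hop : o ≠ p)
  {a : Fin d → Fin d → D} (ha : ∀ i, IsMatrixLayer a (T.lattice (i - 1) p) (T.lattice i p))

include hϖ hF hop ha

theorem exists_inverse_mem {f : Module.End k (E.ℰ 0).V} (hf : f ∈ T.endAlgebra Set.univ)
    (h0 : f ≠ 0) : ∃ g ∈ T.endAlgebra Set.univ, f * g = 1 ∧ g * f = 1 := by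
  obtain ⟨g, hg, hg', h⟩ := hf.1.exists_inverse hF (fun i x => hf.2 i x trivial)
    (hf.1.injective hϖ hF hop ha h0)
  exact ⟨g, ⟨hg, fun i x _ => hg' i x⟩, h⟩

/-- Of two mutually inverse endomorphisms over the complement of the pole, one extends to the
whole curve. -/
theorem mem_univ_or_mem_univ [Nontrivial (E.ℰ 0).V] {f g : Module.End k (E.ℰ 0).V}
    (hf : f ∈ T.endAlgebra {p}ᶜ) (hg : g ∈ T.endAlgebra {p}ᶜ) (hgf : g * f = 1) :
    f ∈ T.endAlgebra Set.univ ∨ g ∈ T.endAlgebra Set.univ := by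
  have hgf0 : g * f ≠ 0 := hgf ▸ one_ne_zero
  obtain ⟨m, hm, hm'⟩ := hf.1.exists_shift hϖ hF hop ha (right_ne_zero_of_mul hgf0)
  obtain ⟨l, hl, hl'⟩ := hg.1.exists_shift hϖ hF hop ha (left_ne_zero_of_mul hgf0)
  have extend {h : Module.End k (E.ℰ 0).V} (hh : h ∈ T.endAlgebra {p}ᶜ) {n : ℤ}
      (hn : ∀ i, ∀ w ∈ T.lattice i p, h w ∈ T.lattice (i + n) p) (hn0 : n ≤ 0) :
      h ∈ T.endAlgebra Set.univ := by
    refine ⟨hh.1, fun i x _ w hw => ?_⟩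
    by_cases hx : x = p
    · subst hx
      exact T.lattice_mono x (by omega) (hn i w hw)
    · exact hh.2 i x hx w hw
  rcases le_or_gt m 0 with h | h
  · exact Or.inl (extend hf hm h)
  refine Or.inr (extend hg hl ?_)
  obtain ⟨w, hw⟩ := exists_ne (0 : (E.ℰ 0).V)
  obtain ⟨i, hi, hi'⟩ := T.exists_level hϖ hF hw
  have hni := hl' _ _ (hm i w hi) (hm' i w hi hi')
  rw [show g (f w) = w from LinearMap.congr_fun hgf w] at hni
  by_contra hlt
  exact hni (T.lattice_mono p (by omega) hi)

theorem autRestrict_bijective [Nontrivial (E.ℰ 0).V] : Function.Bijective E.autRestrict := by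
  have hinj : Function.Injective (E.restrict (Set.subset_univ {p}ᶜ)) :=
    Subring.inclusion_injective _
  refine ⟨Units.map_injective hinj, fun u => ?_⟩
  have hf := T.apply_zero_mem_endAlgebra u.val.2
  have hg := T.apply_zero_mem_endAlgebra u.inv.2
  have hfg : u.val.1 0 * u.inv.1 0 = 1 := congrFun (congrArg Subtype.val u.val_inv) 0
  have hgf : u.inv.1 0 * u.val.1 0 = 1 := congrFun (congrArg Subtype.val u.inv_val) 0
  have inverse {f g : Module.End k (E.ℰ 0).V} (hf : f ∈ T.endAlgebra Set.univ)
      (hgf : g * f = 1) : g ∈ T.endAlgebra Set.univ := by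
    obtain ⟨g', hg', hfg', -⟩ := T.exists_inverse_mem hϖ hF hop ha hf
      (right_ne_zero_of_mul (hgf ▸ one_ne_zero))
    rwa [left_inv_eq_right_inv hgf hfg']
  have hboth : u.val.1 0 ∈ T.endAlgebra Set.univ ∧ u.inv.1 0 ∈ T.endAlgebra Set.univ := by
    rcases T.mem_univ_or_mem_univ hϖ hF hop ha hf hg hgf with h | h
    · exact ⟨h, inverse h hgf⟩
    · exact ⟨inverse h hfg, h⟩
  refine ⟨⟨⟨_, T.mem_endSections_of_apply_zero u.val.2 hboth.1⟩,
    ⟨_, T.mem_endSections_of_apply_zero u.inv.2 hboth.2⟩, ?_, ?_⟩, ?_⟩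
  · exact hinj u.val_inv
  · exact hinj u.inv_val
  · exact Units.ext rfl

/-- The endomorphisms of the elliptic sheaf act by scalars on a graded piece at the pole. -/
theorem exists_character [Nontrivial (E.ℰ 0).V] :
    ∃ χ : T.endAlgebra Set.univ →ₐ[𝔽] k, Function.Injective χ := by
  obtain ⟨u, hu0⟩ := exists_ne (0 : (E.ℰ 0).V)
  obtain ⟨i, hu, hu'⟩ := T.exists_level hϖ hF hu0
  have hex (f : T.endAlgebra Set.univ) :=
    (ha i).exists_sub_smul_mem f.2.1.op_smul (f.2.2 i p trivial) (f.2.2 (i - 1) p trivial)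
  choose c hc using hex
  have huniq {b b' : k} {v : (E.ℰ 0).V} (hb : v - b • u ∈ T.lattice (i - 1) p)
      (hb' : v - b' • u ∈ T.lattice (i - 1) p) : b = b' := by
    by_contra hne
    refine hu' ?_
    have h := Submodule.smul_mem _ (b' - b)⁻¹ (sub_mem hb hb')
    rwa [sub_sub_sub_cancel_left, ← sub_smul, inv_smul_smul₀ (sub_ne_zero.2 (Ne.symm hne))] at h
  let χ : T.endAlgebra Set.univ →ₐ[𝔽] k :=
    { toFun := c
      map_one' := huniq (hc 1 u hu) (by simp)
      map_mul' := fun f g => huniq (hc (f * g) u hu) (by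
        have h := add_mem (f.2.2 _ p trivial _ (hc g u hu))
          (Submodule.smul_mem _ (c g) (hc f u hu))
        rw [map_sub, map_smul, smul_sub, sub_add_sub_cancel, smul_smul, mul_comm (c g)] at h
        exact h)
      map_zero' := huniq (hc 0 u hu) (by simp)
      map_add' := fun f g => huniq (hc (f + g) u hu) (by
        have h := add_mem (hc f u hu) (hc g u hu)
        rw [sub_add_sub_comm, ← add_smul] at h
        exact h)
      commutes' := fun b => huniq (hc _ u hu) (by
        have h : (algebraMap 𝔽 (T.endAlgebra Set.univ) b : Module.End k (E.ℰ 0).V) u =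
            algebraMap 𝔽 k b • u := by
          rw [algebraMap_smul]; rfl
        rw [h, sub_self]
        exact zero_mem _) }
  refine ⟨χ, (injective_iff_map_eq_zero χ).2 fun f hf => ?_⟩
  by_contra h0
  obtain ⟨g, hg, hfg, -⟩ := T.exists_inverse_mem hϖ hF hop ha f.2 (fun h => h0 (Subtype.ext h))
  have h1 : f * ⟨g, hg⟩ = 1 := Subtype.ext hfg
  have h2 := congrArg χ h1
  rw [map_mul, hf, zero_mul, map_one] at h2
  exact zero_ne_one h2

end Trivialization

end EllipticSheaf

end Ring

end DElliptic

end

open scoped TensorProduct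

noncomputable section

namespace DElliptic

universe v

attribute [local instance] TensorProduct.Algebra.module

open MulOpposite Polynomial

theorem card_dvd_of_finrank_eigenspace_of_isField {K N F D : Type*} [CommRing K] (hK : IsField K)
    [AddCommGroup N] [Module K N] [Field F] [DivisionRing D] [Algebra F D] [Algebra.IsCentral F D]
    [FiniteDimensional F D] [Algebra F K] [Module F N] [IsScalarTower F K N] [Module Dᵐᵒᵖ N]
    [IsScalarTower F Dᵐᵒᵖ N] [SMulCommClass K Dᵐᵒᵖ N] {d : ℕ} (hd : Module.finrank F D = d ^ 2)
    (hN : Module.finrank K N = d ^ 2) (f : Module.End K N)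
    (hfD : ∀ (a : D) w, f (op a • w) = op a • f w) (S : Finset K)
    (hf : aeval f (∏ β ∈ S, (X - C β)) = 0)
    (heq : ∀ β ∈ S, ∀ γ ∈ S,
      Module.finrank K (f.eigenspace β) = Module.finrank K (f.eigenspace γ)) :
    S.card ∣ d := by
  let := hK.toField
  exact card_dvd_of_finrank_eigenspace hd hN f hfD S hf heq

variable {𝔽 F D : Type*} [Field 𝔽] [Field F] [Algebra 𝔽 F]
  {k : Type*} [Field k] [Algebra 𝔽 k]

section

variable [Ring D] [Algebra F D] {𝒟 : OrderSheaf 𝔽 F D}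

theorem mem_eigenspace_tensorLinear {n : ℕ} {ℰ : Bundle.{v} 𝒟 k n} {f : Module.End k ℰ.V}
    {hf : ∀ (a : D) w, f (op a • w) = op a • f w} {β : k} {w : ℰ.V} :
    w ∈ (tensorLinear f hf).eigenspace ((1 : F) ⊗ₜ[𝔽] β) ↔ f w = β • w := by
  rw [Module.End.mem_eigenspace_iff, Bundle.tmul_smul_eq, one_smul]
  rfl

theorem aeval_tensorLinear {n : ℕ} {ℰ : Bundle.{v} 𝒟 k n} {f : Module.End k ℰ.V}
    {hf : ∀ (a : D) w, f (op a • w) = op a • f w} (P : k[X]) (w : ℰ.V) :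
    aeval (tensorLinear f hf) (P.map (Algebra.TensorProduct.includeRight :
      k →ₐ[𝔽] F ⊗[𝔽] k).toRingHom) w = aeval f P w := by
  induction P using Polynomial.induction_on generalizing w with
  | C a =>
    rw [Polynomial.map_C, aeval_C, aeval_C, Module.algebraMap_end_apply,
      Module.algebraMap_end_apply]
    exact (Bundle.tmul_smul_eq ℰ 1 a w).trans (one_smul F _)
  | add P Q hP hQ => rw [Polynomial.map_add, map_add, map_add, LinearMap.add_apply, hP, hQ,
      LinearMap.add_apply]
  | monomial n a h =>
    rw [pow_succ, ← mul_assoc, Polynomial.map_mul, map_mul, map_mul, Module.End.mul_apply, h,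
      Module.End.mul_apply, Polynomial.map_X, aeval_X, aeval_X]
    rfl

variable [Fintype 𝔽] [IsAlgClosure 𝔽 k] {d : ℕ} {p o : Place 𝔽 F} {z : o.Residue →ₐ[𝔽] k}
  {E : EllipticSheaf.{v} 𝒟 d p o z}

namespace EllipticSheaf.Trivialization

variable (T : E.Trivialization) {ϖ : F}

variable (𝔽 F k) in
/-- The automorphism `Id ⊗ Fr_q` of `F ⊗ k`. -/
def tensorFrob : F ⊗[𝔽] k ≃ₐ[𝔽] F ⊗[𝔽] k :=
  haveI : Algebra.IsAlgebraic 𝔽 k := IsAlgClosure.isAlgebraic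
  Algebra.TensorProduct.congr AlgEquiv.refl (FiniteField.frobeniusAlgEquivOfAlgebraic 𝔽 k)

theorem tensorFrob_tmul (f : F) (a : k) :
    tensorFrob 𝔽 F k (f ⊗ₜ a) = f ⊗ₜ frob 𝔽 k a := rfl

theorem frobenius_tensor_smul (c : F ⊗[𝔽] k) (w : (E.ℰ 0).V) :
    T.frobenius (c • w) = tensorFrob 𝔽 F k c • T.frobenius w := by
  induction c using TensorProduct.induction_on with
  | zero => simp
  | add c c' h h' => rw [add_smul, map_add, h, h', map_add, add_smul]
  | tmul g a => rw [tensorFrob_tmul, Bundle.tmul_smul_eq, frobenius_smul_field, map_smulₛₗ,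
      Bundle.tmul_smul_eq]

/-- The Frobenius permutes the eigenspaces of an endomorphism. -/
theorem finrank_eigenspace_pow (hϖ : p.IsUniformizer ϖ) (hF : IsCurveFunctionField 𝔽 F)
    (hop : o ≠ p) {f : Module.End k (E.ℰ 0).V} (hf : T.Commutes f) (β : k) :
    Module.finrank (F ⊗[𝔽] k)
        ((tensorLinear f hf.op_smul).eigenspace ((1 : F) ⊗ₜ[𝔽] (β ^ Fintype.card 𝔽))) =
      Module.finrank (F ⊗[𝔽] k)
        ((tensorLinear f hf.op_smul).eigenspace ((1 : F) ⊗ₜ[𝔽] β)) := by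
  have hmem (w : (E.ℰ 0).V) :
      T.frobenius w ∈ (tensorLinear f hf.op_smul).eigenspace
        ((1 : F) ⊗ₜ[𝔽] (β ^ Fintype.card 𝔽)) ↔
      w ∈ (tensorLinear f hf.op_smul).eigenspace ((1 : F) ⊗ₜ[𝔽] β) := by
    rw [mem_eigenspace_tensorLinear, mem_eigenspace_tensorLinear, hf.frobenius, ← frob_apply,
      ← map_smulₛₗ, T.frobenius_injective.eq_iff]
  let e : (tensorLinear f hf.op_smul).eigenspace ((1 : F) ⊗ₜ[𝔽] β) →+
      (tensorLinear f hf.op_smul).eigenspace ((1 : F) ⊗ₜ[𝔽] (β ^ Fintype.card 𝔽)) :=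
    { toFun := fun w => ⟨T.frobenius w, (hmem w).2 w.2⟩
      map_zero' := Subtype.ext (map_zero T.frobenius)
      map_add' := fun v w => Subtype.ext (map_add T.frobenius (v : (E.ℰ 0).V) w) }
  have he : Function.Bijective e := by
    constructor
    · exact fun v w h => Subtype.ext (T.frobenius_injective (congrArg Subtype.val h))
    · rintro ⟨w, hw⟩
      obtain ⟨v, rfl⟩ := T.frobenius_surjective hϖ hF hop w
      exact ⟨⟨v, (hmem v).1 hw⟩, rfl⟩
  refine congrArg Cardinal.toNat (rank_eq_of_equiv_equiv (tensorFrob 𝔽 F k)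
    (AddEquiv.ofBijective e he) (tensorFrob 𝔽 F k).bijective fun c w => ?_).symm
  exact Subtype.ext (T.frobenius_tensor_smul c w)

end EllipticSheaf.Trivialization

end

variable [DivisionRing D] [Algebra F D] [FiniteDimensional F D] [Algebra.IsCentral F D]
  {𝒟 : OrderSheaf 𝔽 F D} [Fintype 𝔽] [IsAlgClosure 𝔽 k] {d : ℕ} {p o : Place 𝔽 F}
  {z : o.Residue →ₐ[𝔽] k} {E : EllipticSheaf.{v} 𝒟 d p o z}

namespace EllipticSheaf.Trivialization

variable (T : E.Trivialization) {ϖ : F}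

theorem natDegree_minpoly_dvd (hϖ : p.IsUniformizer ϖ) (hF : IsCurveFunctionField 𝔽 F)
    (hop : o ≠ p) (hd : Module.finrank F D = d ^ 2) {f : Module.End k (E.ℰ 0).V}
    (hf : T.Commutes f) {c : k} (hc : aeval f (minpoly 𝔽 c) = 0) :
    (minpoly 𝔽 c).natDegree ∣ d := by
  classical
  have : Algebra.IsAlgebraic 𝔽 k := IsAlgClosure.isAlgebraic
  have : IsAlgClosed k := IsAlgClosure.isAlgClosed 𝔽
  have hK : IsField (F ⊗[𝔽] k) := hF.isField_tensorProduct
  have : Nontrivial (F ⊗[𝔽] k) := hK.nontrivial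
  let ι : k →ₐ[𝔽] F ⊗[𝔽] k := Algebra.TensorProduct.includeRight
  have hι : Function.Injective ι := ι.toRingHom.injective
  have hint : IsIntegral 𝔽 c := Algebra.IsIntegral.isIntegral c
  have hsep : (minpoly 𝔽 c).Separable :=
    PerfectField.separable_of_irreducible (minpoly.irreducible hint)
  let R : Finset k := ((minpoly 𝔽 c).aroots k).toFinset
  have hnodup : ((minpoly 𝔽 c).aroots k).Nodup := nodup_roots hsep.map
  have hcard : R.card = (minpoly 𝔽 c).natDegree := by
    rw [Multiset.toFinset_card_of_nodup hnodup]
    exact IsAlgClosed.card_aroots_eq_natDegree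
  have hprod : (minpoly 𝔽 c).map (algebraMap 𝔽 k) = ∏ β ∈ R, (X - C β) := by
    rw [(IsAlgClosed.splits ((minpoly 𝔽 c).map (algebraMap 𝔽 k))).eq_prod_roots_of_monic
      ((minpoly.monic hint).map _), Finset.prod_multiset_map_count]
    refine Finset.prod_congr rfl fun β hβ => ?_
    rw [Multiset.count_eq_one_of_mem hnodup (Multiset.mem_toFinset.1 hβ), pow_one]
  have hroot (β : k) (hβ : β ∈ R) : ∃ n : ℕ, β = c ^ Fintype.card 𝔽 ^ n := by
    refine exists_eq_pow_of_aeval_minpoly ?_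
    rw [Multiset.mem_toFinset, mem_aroots] at hβ
    exact hβ.2
  have hfin (n : ℕ) : Module.finrank (F ⊗[𝔽] k)
        ((tensorLinear f hf.op_smul).eigenspace (ι (c ^ Fintype.card 𝔽 ^ n))) =
      Module.finrank (F ⊗[𝔽] k) ((tensorLinear f hf.op_smul).eigenspace (ι c)) := by
    induction n with
    | zero => rw [pow_zero, pow_one]
    | succ n ih =>
      rw [← ih, pow_succ (Fintype.card 𝔽), pow_mul]
      exact T.finrank_eigenspace_pow hϖ hF hop hf _
  rw [← hcard, ← Finset.card_image_of_injective R hι]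
  have : IsScalarTower F (F ⊗[𝔽] k) (E.ℰ 0).V :=
    ⟨fun g c w => (E.ℰ 0).smul_smul_tensor g c w⟩
  have : SMulCommClass (F ⊗[𝔽] k) Dᵐᵒᵖ (E.ℰ 0).V := by
    refine ⟨fun c a w => ?_⟩
    induction c using TensorProduct.induction_on with
    | zero => simp
    | add c c' h h' => rw [add_smul, h, h', add_smul, smul_add]
    | tmul g b =>
      rw [Bundle.tmul_smul_eq, Bundle.tmul_smul_eq, Bundle.smul_eq_op_smul, Bundle.smul_eq_op_smul,
        smul_comm b a, smul_smul, smul_smul, ← MulOpposite.algebraMap_apply, Algebra.commutes]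
  obtain ⟨b, -⟩ := (E.ℰ 0).exists_basis p
  refine card_dvd_of_finrank_eigenspace_of_isField hK hd ?_ (tensorLinear f hf.op_smul)
    hf.op_smul (R.image ι) ?_ ?_
  · rw [Module.finrank_eq_card_basis b, Fintype.card_fin]
  · rw [Finset.prod_image fun β _ γ _ h => hι h]
    have hmap : ∏ β ∈ R, (X - C (ι β)) = ((minpoly 𝔽 c).map (algebraMap 𝔽 k)).map ι.toRingHom := by
      rw [hprod, Polynomial.map_prod]
      simp
    rw [hmap]
    refine LinearMap.ext fun w => ?_
    rw [aeval_tensorLinear, aeval_map_algebraMap, hc]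
    rfl
  · intro β hβ γ hγ
    obtain ⟨β, hβR, rfl⟩ := Finset.mem_image.1 hβ
    obtain ⟨γ, hγR, rfl⟩ := Finset.mem_image.1 hγ
    obtain ⟨n, rfl⟩ := hroot β hβR
    obtain ⟨m, rfl⟩ := hroot γ hγR
    rw [hfin, hfin]

variable (hϖ : p.IsUniformizer ϖ) (hF : IsCurveFunctionField 𝔽 F) (hop : o ≠ p)
  {a : Fin d → Fin d → D} (ha : ∀ i, IsMatrixLayer a (T.lattice (i - 1) p) (T.lattice i p))

include hϖ hF hop ha

/-- The endomorphism ring of the elliptic sheaf is a field of degree dividing `d`. -/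
theorem exists_endAlgebra_equiv (hdpos : 0 < d) (hd : Module.finrank F D = d ^ 2)
    [Nontrivial (E.ℰ 0).V] :
    ∃ L : IntermediateField 𝔽 k,
      Module.finrank 𝔽 L ∣ d ∧ Nonempty (T.endAlgebra Set.univ ≃+* L) := by
  have : Algebra.IsAlgebraic 𝔽 k := IsAlgClosure.isAlgebraic
  obtain ⟨χ, hχ⟩ := T.exists_character hϖ hF hop ha
  refine ⟨χ.range.toIntermediateField fun c hc =>
      χ.range.inv_mem_of_algebraic (x := ⟨c, hc⟩) (Algebra.IsAlgebraic.isAlgebraic _),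
    finrank_dvd_of_natDegree_dvd hdpos _ ?_, ⟨(AlgEquiv.ofInjective χ hχ).toRingEquiv⟩⟩
  rintro _ ⟨f, rfl⟩
  refine T.natDegree_minpoly_dvd hϖ hF hop hd f.2.1 ?_
  have h : aeval f (minpoly 𝔽 (χ f)) = 0 := hχ (by
    rw [← aeval_algHom_apply, minpoly.aeval, map_zero])
  have := congrArg (T.endAlgebra Set.univ).val h
  rwa [← aeval_algHom_apply, map_zero] at this

end EllipticSheaf.Trivialization

end DElliptic

end

theorem mainTheorem7 {𝔽 F D k : Type*} [Field 𝔽] [Fintype 𝔽] [Field F] [Algebra 𝔽 F]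
    (hF : DElliptic.IsCurveFunctionField 𝔽 F)
    [Field k] [Algebra 𝔽 k] [IsAlgClosure 𝔽 k]
    [DivisionRing D] [Algebra F D] [FiniteDimensional F D] [Algebra.IsCentral F D]
    (d : ℕ) (hd : Module.finrank F D = d ^ 2)
    (𝒟 : DElliptic.OrderSheaf 𝔽 F D) (h𝒟 : 𝒟.IsMaximal)
    (infty o : DElliptic.Place 𝔽 F) (ho : o ≠ infty)
    (h_split : infty.IsSplit D d) (h_inv : o.HasInvariantOneDiv D d)
    (z : o.Residue →ₐ[𝔽] k)
    (E : DElliptic.EllipticSheaf 𝒟 d infty o z) (hE : E.IsExceptional) :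
    Function.Bijective E.autRestrict ∧
      ∃ s : ℕ, s ∣ d ∧ ∃ L : IntermediateField 𝔽 k,
        Module.finrank 𝔽 L = s ∧ Nonempty (E.Λˣ ≃* Lˣ) := by
  have hdpos : 0 < d := by
    rcases Nat.eq_zero_or_pos d with rfl | h
    · have := Module.finrank_pos (R := F) (M := D)
      omega
    · exact h
  obtain ⟨ϖ, hϖ⟩ := infty.exists_isUniformizer hF
  obtain ⟨a, ha, hmul, hone⟩ := h𝒟.exists_matrixUnits hd h_split hϖ
  obtain ⟨T⟩ := E.nonempty_trivialization hϖ hF hdpos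
  have hlayer := T.isMatrixLayer_lattice hϖ hF hdpos ha hmul hone
  have := E.nontrivial_fibre hF hdpos
  have hbij := T.autRestrict_bijective hϖ hF ho hlayer
  obtain ⟨L, hL, ⟨e⟩⟩ := T.exists_endAlgebra_equiv hϖ hF ho hlayer hdpos hd
  exact ⟨hbij, _, hL, L, rfl, ⟨(MulEquiv.ofBijective _ hbij).symm.trans
    (Units.mapEquiv ((T.endSectionsEquiv Set.univ).trans e).toMulEquiv)⟩⟩
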